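/- **Theorem 1.** Let $N,L\ge 0$ and $p+q=N+L$, and let $E=\mathbb R^{p,q}$ be the pseudo-Euclidean space of signature $(p,q)$ with scalar product $(\cdot,\cdot)$. A (parametrized, totally nonisotropic) *torsionless submanifold* on an open set $U\subset\mathbb R^N$ is a $C^\infty$ map $r:U\to E$, together with $C^\infty$ normal fields $n_1,\dots,n_L:U\to E$, such that $r_{u^1},\dots,r_{u^N},n_1,\dots,n_L$ is a basis of $E$ at each point, the first fundamental form $g_{ij}=(r_{u^i},r_{u^j})$ is nondegenerate, $(n_\alpha,r_{u^i})=0$, the Gram matrix $(n_\alpha,n_\beta)=\mu_{\alpha\beta}$ is constant, and the torsion vanishes: $(n_{\alpha,u^i},n_\beta)=0$. It is *flat* if the Riemann curvature tensor of $g$ vanishes. Its second fundamental forms are $\omega_{\alpha,ij}=(n_\alpha,r_{u^iu^j})$. (a) (*Flat coordinates.*) For each flat torsionless submanifold and each point $u_0\in U$ there is a $C^\infty$ change of coordinates from a simply connected domain onto a neighbourhood of $u_0$ in $U$, after which the first fundamental form is a constant matrix $\eta_{ij}$ (and the submanifold is still flat and torsionless, with the same Gram matrix $\mu$). (b) (*From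 submanifolds to solutions.*) Let $U$ be a simply connected open set and let $(r,n)$ be a flat torsionless submanifold on $U$ in flat coordinates, i.e. with constant first fundamental form $\mathbf I=\eta_{ij}\,du^idu^j$. Then $\eta$ and $\mu$ are symmetric and nondegenerate, the signature $(p,q)$ of $E$ is the sum of the signatures of $\eta$ and $\mu$, and there are $C^\infty$ functions $\psi_1,\dots,\psi_L$ on $U$ such that the second fundamental forms are their Hessians, $$\mathbf{II}_\alpha=\frac{\partial^2\psi_\alpha}{\partial u^i\partial u^j}\,du^idu^j,$$ and that satisfy the Gauss equations, for all $i,j,k,l$, $$\sum_{\alpha,\beta=1}^L\mu^{\alpha\beta}\left(\frac{\partial^2\psi_\alpha}{\partial u^i\partial u^k}\frac{\partial^2\psi_\beta}{\partial u^j\partial u^l}-\frac{\partial^2\psi_\alpha}{\partial u^i\partial u^l}\frac{\partial^2\psi_\beta}{\partial u^j\partial u^k}\right)=0\qquad(\mathrm{g3})$$ and the Ricci equations, for all $\alpha,\beta,k,l$, $$\sum_{i,j=1}^N\eta^{ij}\left(\frac{\partial^2\psi_\alpha}{\partial u^i\partial u^k}\frac{\partial^2\psi_\beta}{\partial u^j\partial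 u^l}-\frac{\partial^2\psi_\alpha}{\partial u^i\partial u^l}\frac{\partial^2\psi_\beta}{\partial u^j\partial u^k}\right)=0,\qquad(\mathrm{r3})$$ where $(\eta^{ij})$ and $(\mu^{\alpha\beta})$ are the inverses of $(\eta_{ij})$ and $(\mu_{\alpha\beta})$. The solutions with these Hessians are exactly the families that differ from $(\psi_\alpha)$ by affine functions $a_{\alpha i}u^i+c_\alpha$. (c) (*From solutions to submanifolds.*) Conversely, let $\eta$ ($N\times N$) and $\mu$ ($L\times L$) be arbitrary constant nondegenerate symmetric matrices whose signatures add up to $(p,q)$, let $U\subset\mathbb R^N$ be open and simply connected, and let $\psi_1,\dots,\psi_L$ be a $C^\infty$ solution of (g3), (r3) on $U$. Then there is a flat torsionless submanifold $(r,n)$ on $U$ in $E$ with $(n_\alpha,n_\beta)=\mu_{\alpha\beta}$, first fundamental form $\eta_{ij}\,du^idu^j$ and second fundamental forms the Hessians of the $\psi_\alpha$. It is unique up to motions of $E$: any other such $(r',n')$ is $r'=Tr+c$, $n'_\alpha=Tn_\alpha$ on $U$ for some linear isometry $T$ of $E$ and some $c\in E$. -/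

import Mathlib

open scoped ContDiff

namespace Submfd

noncomputable section

/-- The underlying vector space of the pseudo-Euclidean space of signature `(p, q)`. -/
abbrev PseudoE (p q : ℕ) : Type := Fin p ⊕ Fin q → ℝ

/-- The scalar product of signature `(p, q)`:
`(x, y) = x₁y₁ + ⋯ + x_p y_p - x_{p+1}y_{p+1} - ⋯ - x_{p+q}y_{p+q}`. -/
def pseudoInner {p q : ℕ} (x y : PseudoE p q) : ℝ :=
  ∑ a : Fin p, x (Sum.inl a) * y (Sum.inl a) - ∑ b : Fin q, x (Sum.inr b) * y (Sum.inr b)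

/-- The partial derivative `∂f/∂uⁱ` at the point `u`. -/
def pd {N : ℕ} {E : Type} [NormedAddCommGroup E] [NormedSpace ℝ E]
    (i : Fin N) (f : (Fin N → ℝ) → E) (u : Fin N → ℝ) : E :=
  fderiv ℝ f u (Pi.single i 1)

/-- The first fundamental form `g_{ij} = (r_{uⁱ}, r_{uʲ})`. -/
def firstForm {N p q : ℕ} (r : (Fin N → ℝ) → PseudoE p q) (u : Fin N → ℝ) :
    Matrix (Fin N) (Fin N) ℝ :=
  Matrix.of fun i j => pseudoInner (pd i r u) (pd j r u)

/-- The second fundamental form `ω_{ij} = (m, r_{uⁱuʲ})` belonging to one normal field `m`. -/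
def secondForm {N p q : ℕ} (r m : (Fin N → ℝ) → PseudoE p q) (u : Fin N → ℝ) :
    Matrix (Fin N) (Fin N) ℝ :=
  Matrix.of fun i j => pseudoInner (m u) (pd j (pd i r) u)

/-- The coefficient of torsion `(n_{α,uⁱ}, n_β)` (with the normal index `β` lowered). -/
def torsion {N L p q : ℕ} (n : Fin L → (Fin N → ℝ) → PseudoE p q)
    (α β : Fin L) (i : Fin N) (u : Fin N → ℝ) : ℝ :=
  pseudoInner (pd i (n α) u) (n β u)

/-- The Hessian matrix `∂²ψ/∂uⁱ∂uʲ`. -/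
def hessian {N : ℕ} (ψ : (Fin N → ℝ) → ℝ) (u : Fin N → ℝ) : Matrix (Fin N) (Fin N) ℝ :=
  Matrix.of fun i j => pd j (pd i ψ) u

/-- The Christoffel symbol `Γᵏ_{ij}` of the Levi-Civita connection of the metric `g`. -/
def christoffel {N : ℕ} (g : (Fin N → ℝ) → Matrix (Fin N) (Fin N) ℝ) (k i j : Fin N)
    (u : Fin N → ℝ) : ℝ :=
  (1 / 2 : ℝ) * ∑ s, (g u)⁻¹ k s *
    (pd i (fun v => g v j s) u + pd j (fun v => g v i s) u - pd s (fun v => g v i j) u)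

/-- The component `Rˡ_{kij}` of the Riemann curvature tensor of the metric `g`. -/
def riemann {N : ℕ} (g : (Fin N → ℝ) → Matrix (Fin N) (Fin N) ℝ) (l k i j : Fin N)
    (u : Fin N → ℝ) : ℝ :=
  pd i (christoffel g l j k) u - pd j (christoffel g l i k) u
    + ∑ m, (christoffel g l i m u * christoffel g m j k u
      - christoffel g l j m u * christoffel g m i k u)

/-- `r : U → ℝ^{p,q}` is a parametrized flat torsionless totally nonisotropic smooth submanifold,
and `n` is a smooth frame of its normal spaces with constant Gram matrix `μ` and zero torsion
(a basis of the normal spaces when `p + q = N + L`). -/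
structure IsFlatTorsionless {N L p q : ℕ} (U : Set (Fin N → ℝ)) (μ : Matrix (Fin L) (Fin L) ℝ)
    (r : (Fin N → ℝ) → PseudoE p q) (n : Fin L → (Fin N → ℝ) → PseudoE p q) : Prop where
  smooth_r : ContDiffOn ℝ ∞ r U
  smooth_n : ∀ α, ContDiffOn ℝ ∞ (n α) U
  /-- the tangent vectors `r_{uⁱ}` and the normals `n_α` are linearly independent -/
  linearIndependent : ∀ u ∈ U, LinearIndependent ℝ
    (Sum.elim (fun i : Fin N => pd i r u) (fun α : Fin L => n α u))
  nonisotropic : ∀ u ∈ U, (firstForm r u).det ≠ 0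
  normal : ∀ u ∈ U, ∀ α i, pseudoInner (n α u) (pd i r u) = 0
  gram : ∀ u ∈ U, ∀ α β, pseudoInner (n α u) (n β u) = μ α β
  torsionless : ∀ u ∈ U, ∀ α β i, torsion n α β i u = 0
  flat : ∀ u ∈ U, ∀ l k i j, riemann (firstForm r) l k i j u = 0

/-- `(r, n)` is a flat torsionless submanifold with normal frame of Gram matrix `μ`, referred to
flat coordinates in which the first fundamental form is the constant matrix `η`. -/
def IsFlatTorsionlessIn {N L p q : ℕ} (U : Set (Fin N → ℝ)) (η : Matrix (Fin N) (Fin N) ℝ)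
    (μ : Matrix (Fin L) (Fin L) ℝ) (r : (Fin N → ℝ) → PseudoE p q)
    (n : Fin L → (Fin N → ℝ) → PseudoE p q) : Prop :=
  IsFlatTorsionless U μ r n ∧ ∀ u ∈ U, firstForm r u = η

/-- The second fundamental forms of `(r, n)` on `U` are the Hessians of the functions `ψ_α`. -/
def HasHessianForms {N L p q : ℕ} (U : Set (Fin N → ℝ)) (r : (Fin N → ℝ) → PseudoE p q)
    (n : Fin L → (Fin N → ℝ) → PseudoE p q) (ψ : Fin L → (Fin N → ℝ) → ℝ) : Prop :=
  ∀ u ∈ U, ∀ α, secondForm r (n α) u = hessian (ψ α) u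

/-- The Gauss equations in flat coordinates. -/
def GaussEqs {N L : ℕ} (U : Set (Fin N → ℝ)) (μ : Matrix (Fin L) (Fin L) ℝ)
    (ψ : Fin L → (Fin N → ℝ) → ℝ) : Prop :=
  ∀ u ∈ U, ∀ i j k l : Fin N, ∑ α, ∑ β, μ⁻¹ α β *
    (hessian (ψ α) u i k * hessian (ψ β) u j l - hessian (ψ α) u i l * hessian (ψ β) u j k) = 0

/-- The Ricci equations in flat coordinates. -/
def RicciEqs {N L : ℕ} (U : Set (Fin N → ℝ)) (η : Matrix (Fin N) (Fin N) ℝ)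
    (ψ : Fin L → (Fin N → ℝ) → ℝ) : Prop :=
  ∀ u ∈ U, ∀ (α β : Fin L) (k l : Fin N), ∑ i, ∑ j, η⁻¹ i j *
    (hessian (ψ α) u i k * hessian (ψ β) u j l - hessian (ψ α) u i l * hessian (ψ β) u j k) = 0

/-- A smooth solution `ψ_1, …, ψ_L` on `U` of the Gauss and Ricci equations. -/
def IsSolution {N L : ℕ} (U : Set (Fin N → ℝ)) (η : Matrix (Fin N) (Fin N) ℝ)
    (μ : Matrix (Fin L) (Fin L) ℝ) (ψ : Fin L → (Fin N → ℝ) → ℝ) : Prop :=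
  (∀ α, ContDiffOn ℝ ∞ (ψ α) U) ∧ GaussEqs U μ ψ ∧ RicciEqs U η ψ

/-- A constant nondegenerate symmetric matrix. -/
def IsMetric {k : ℕ} (A : Matrix (Fin k) (Fin k) ℝ) : Prop := A.IsSymm ∧ A.det ≠ 0

/-- The signature `(p, q)` is the sum of the signatures of `η` and `μ`. -/
def SignatureSum {N L : ℕ} (p q : ℕ) (η : Matrix (Fin N) (Fin N) ℝ)
    (μ : Matrix (Fin L) (Fin L) ℝ) : Prop :=
  p = sigPos η.toQuadraticForm' + sigPos μ.toQuadraticForm' ∧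
    q = sigNeg η.toQuadraticForm' + sigNeg μ.toQuadraticForm'

/-- Some motion `z ↦ T z + c` of `ℝ^{p,q}` (`T` preserves the scalar product) carries `(r, n)`
to `(r', n')`. -/
def Congruent {N L p q : ℕ} (U : Set (Fin N → ℝ)) (r r' : (Fin N → ℝ) → PseudoE p q)
    (n n' : Fin L → (Fin N → ℝ) → PseudoE p q) : Prop :=
  ∃ (T : PseudoE p q ≃ₗ[ℝ] PseudoE p q) (c : PseudoE p q),
    (∀ x y, pseudoInner (T x) (T y) = pseudoInner x y) ∧
    ∀ u ∈ U, r' u = T (r u) + c ∧ ∀ α, n' α u = T (n α u)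

end

end Submfd

/-!
In flat coordinates the Gauss and Weingarten formulas say that the adapted frame
`(r_{u¹}, …, r_{uᴺ}, n_1, …, n_L)` is parallel for a linear connection `∂ₖ - aₖ` whose matrices are
built from `η`, `μ` and the second fundamental forms. The blocks of its curvature are the Codazzi
equations, which say that the second fundamental forms are Hessians, and the Gauss and Ricci
equations. Conversely, zero curvature produces parallel frames on a simply connected domain, by
continuing local solutions of the total differential system along its covering space of leaves.
The connection preserves the Gram matrix `η ⊕ μ`, so a frame which is adapted at one point, and
such a frame exists when the signatures add up, stays adapted; its tangent vectors integrate to the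
submanifold, and two parallel frames with the same Gram matrix differ by an isometry. Flat
coordinates come from the same argument for the Levi-Civita connection of the first fundamental
form: the rows of a parallel matrix are the partial derivatives of the coordinate functions.
-/

namespace Submfd

open Set Metric Filter Topology

section TotalSystem

variable {E V : Type*} [NormedAddCommGroup E] [NormedSpace ℝ E]
  [NormedAddCommGroup V] [NormedSpace ℝ V]
  {A : E → E →L[ℝ] V →L[ℝ] V} {Y Z : E → V} {U B : Set E} {a u x : E}

/-- `Y` satisfies the total linear system `dY = A Y` at the point `u`. -/
def SolvesAt (A : E → E →L[ℝ] V →L[ℝ] V) (Y : E → V) (u : E) : Prop :=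
  HasFDerivAt Y ((ContinuousLinearMap.apply ℝ V (Y u)).comp (A u)) u

/-- The total linear system `dY = A Y` is completely integrable at the point `u`: the second
derivative of `Y` at `u` that it prescribes is symmetric. -/
def IntegrableAt (A : E → E →L[ℝ] V →L[ℝ] V) (u : E) : Prop :=
  ∀ x y : E, fderiv ℝ A u x y + (A u y).comp (A u x) = fderiv ℝ A u y x + (A u x).comp (A u y)

theorem hasDerivAt_ray (a x : E) (t : ℝ) : HasDerivAt (fun t : ℝ => a + t • x) x t := by
  simpa using ((hasDerivAt_id t).smul_const x).const_add a

theorem SolvesAt.hasDerivWithinAt_ray {t : ℝ} (h : SolvesAt A Y (a + t • x)) (s : Set ℝ) :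
    HasDerivWithinAt (fun t : ℝ => Y (a + t • x)) (A (a + t • x) x (Y (a + t • x))) s t :=
  (HasFDerivAt.comp_hasDerivAt (f := fun t : ℝ => a + t • x) t h
    (hasDerivAt_ray a x t)).hasDerivWithinAt

theorem SolvesAt.eqOn_of_convex (hB : Convex ℝ B) (hA : ContinuousOn A B)
    (hY : ∀ u ∈ B, SolvesAt A Y u) (hZ : ∀ u ∈ B, SolvesAt A Z u) (ha : a ∈ B)
    (haYZ : Y a = Z a) : EqOn Y Z B := by
  intro u hu
  set x := u - a with hx
  have hray : ∀ t ∈ Icc (0 : ℝ) 1, a + t • x ∈ B := fun t ht => hB.add_smul_sub_mem ha hu ht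
  obtain ⟨K, hK⟩ := isCompact_Icc.exists_bound_of_continuousOn
    ((hA.comp (by fun_prop) hray).clm_apply (continuousOn_const (c := x)))
  have hderiv : ∀ t ∈ Icc (0 : ℝ) 1, ∀ s, HasDerivWithinAt
      (fun t : ℝ => Y (a + t • x) - Z (a + t • x))
      (A (a + t • x) x (Y (a + t • x) - Z (a + t • x))) s t := fun t ht s => by
    rw [map_sub]
    exact ((hY _ (hray t ht)).hasDerivWithinAt_ray s).sub
      ((hZ _ (hray t ht)).hasDerivWithinAt_ray s)
  have hzero := eq_zero_of_abs_deriv_le_mul_abs_self_of_eq_zero_right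
    (fun t ht => (hderiv t ht _).continuousWithinAt)
    (fun t ht => hderiv t (Ico_subset_Icc_self ht) _) (by simp [haYZ])
    (fun t ht => ContinuousLinearMap.le_of_opNorm_le _ (hK t (Ico_subset_Icc_self ht)) _)
    1 (by simp)
  simpa [hx, sub_eq_zero] using hzero

theorem SolvesAt.eventuallyEq (hU : IsOpen U) (hA : ContinuousOn A U) (ha : a ∈ U)
    (hY : ∀ᶠ u in 𝓝 a, SolvesAt A Y u) (hZ : ∀ᶠ u in 𝓝 a, SolvesAt A Z u) (haYZ : Y a = Z a) :
    Y =ᶠ[𝓝 a] Z := by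
  obtain ⟨ρ, hρ, h⟩ := Metric.eventually_nhds_iff_ball.1 ((hY.and hZ).and (hU.mem_nhds ha))
  filter_upwards [ball_mem_nhds a hρ] with u hu
  exact SolvesAt.eqOn_of_convex (convex_ball a ρ) (hA.mono fun w hw => (h w hw).2)
    (fun w hw => (h w hw).1.1) (fun w hw => (h w hw).1.2) (mem_ball_self hρ) haYZ hu

theorem SolvesAt.contDiffOn (hU : IsOpen U) (hA : ContDiffOn ℝ ∞ A U)
    (hY : ∀ u ∈ U, SolvesAt A Y u) : ContDiffOn ℝ ∞ Y U := by
  rw [contDiffOn_infty]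
  intro n
  induction n with
  | zero => exact contDiffOn_zero.2 fun u hu => (hY u hu).continuousAt.continuousWithinAt
  | succ n ih =>
    rw [Nat.cast_add, Nat.cast_one, contDiffOn_succ_iff_fderiv_of_isOpen hU]
    refine ⟨fun u hu => (hY u hu).differentiableAt.differentiableWithinAt, by simp, ?_⟩
    have hcomp : ContDiffOn ℝ n
        (fun u => (ContinuousLinearMap.apply ℝ V (Y u)).comp (A u)) U :=
      (contDiffOn_const.clm_apply ih).clm_comp (contDiffOn_infty.1 hA n)
    exact hcomp.congr fun u hu => (hY u hu).fderiv

end TotalSystem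

section LocalExistence

set_option maxSynthPendingDepth 6

variable {E V : Type*} [NormedAddCommGroup E] [NormedSpace ℝ E]
  [NormedAddCommGroup V] [NormedSpace ℝ V]
  {A : E → E →L[ℝ] V →L[ℝ] V} {B : Set E} {M D K C : ℝ} {a u u' : E} {y y' : ℝ → V} {t : ℝ}

/-- `y` solves on `[0, 1]` the ordinary differential equation that the system `dY = A Y` imposes on
`t ↦ Y (a + t (u - a))`. -/
def IsRaySolution (A : E → E →L[ℝ] V →L[ℝ] V) (a u : E) (y : ℝ → V) : Prop :=
  ∀ t ∈ Icc (0 : ℝ) 1, HasDerivWithinAt y (A (a + t • (u - a)) (u - a) (y t)) (Icc 0 1) t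

/-- `B` is a small open convex set on which the completely integrable system `dY = A Y` is
controlled by the bounds `M` for `A` and `K` for its first two derivatives, `D` being a bound for
the diameter of `B`. The smallness `M * D ≤ 1 / 2` makes the Picard–Lindelöf theorem applicable up
to time `1` along the rays of `B`. -/
structure IsControlledOn (A : E → E →L[ℝ] V →L[ℝ] V) (B : Set E) (M D K : ℝ) : Prop where
  isOpen : IsOpen B
  convex : Convex ℝ B
  hasFDerivAt : ∀ w ∈ B, HasFDerivAt A (fderiv ℝ A w) w
  integrableAt : ∀ w ∈ B, IntegrableAt A w
  norm_le : ∀ w ∈ B, ‖A w‖ ≤ M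
  norm_fderiv_le : ∀ w ∈ B, ‖fderiv ℝ A w‖ ≤ K
  norm_taylor_le : ∀ w ∈ B, ∀ w' ∈ B, ‖A w' - A w - fderiv ℝ A w (w' - w)‖ ≤ K * ‖w' - w‖ ^ 2
  norm_sub_le : ∀ w ∈ B, ∀ w' ∈ B, ‖w' - w‖ ≤ D
  mul_le : M * D ≤ 1 / 2

theorem exists_linear_ode_solution [CompleteSpace V] {c : ℝ → V →L[ℝ] V}
    (hc : ContinuousOn c (Icc 0 1)) (hb : ∀ t ∈ Icc (0 : ℝ) 1, ‖c t‖ ≤ 1 / 2) (v : V) :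
    ∃ y : ℝ → V, y 0 = v ∧
      ∀ t ∈ Icc (0 : ℝ) 1, HasDerivWithinAt y (c t (y t)) (Icc 0 1) t := by
  -- A solution stays in the ball of radius `‖v‖ + 1` about `v`, where `‖c t z‖ ≤ ‖v‖ + 1`.
  have h : IsPicardLindelof (fun t z => c t z) (tmin := 0) (tmax := 1) ⟨0, by simp⟩ v
      (‖v‖₊ + 1) 0 (‖v‖₊ + 1) (1 / 2) := by
    refine ⟨fun t ht => ?_, fun z _ => hc.clm_apply continuousOn_const, fun t ht z hz => ?_, ?_⟩
    · exact ((c t).lipschitz.weaken (by simpa [← NNReal.coe_le_coe] using hb t ht)).lipschitzOnWith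
    · rw [mem_closedBall, dist_eq_norm] at hz
      refine ((c t).le_of_opNorm_le (hb t ht) z).trans ?_
      have := norm_le_norm_add_norm_sub' z v
      push_cast at hz ⊢
      linarith
    · simp
  exact h.exists_eq_forall_mem_Icc_hasDerivWithinAt₀

namespace IsControlledOn

theorem continuousOn (h : IsControlledOn A B M D K) : ContinuousOn A B :=
  fun w hw => (h.hasFDerivAt w hw).continuousAt.continuousWithinAt

theorem ray_mem (h : IsControlledOn A B M D K) (ha : a ∈ B) (hu : u ∈ B)
    (ht : t ∈ Icc (0 : ℝ) 1) : a + t • (u - a) ∈ B :=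
  h.convex.add_smul_sub_mem ha hu ht

theorem norm_apply_sub_le (h : IsControlledOn A B M D K) {w : E} (hw : w ∈ B) (ha : a ∈ B)
    (hu : u ∈ B) : ‖A w (u - a)‖ ≤ 1 / 2 :=
  ((A w).le_of_opNorm_le_of_le (h.norm_le w hw) (h.norm_sub_le a ha u hu)).trans h.mul_le

theorem norm_image_sub_le (h : IsControlledOn A B M D K) {w w' : E} (hw : w ∈ B) (hw' : w' ∈ B) :
    ‖A w' - A w‖ ≤ K * ‖w' - w‖ :=
  h.convex.norm_image_sub_le_of_norm_hasFDerivWithin_le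
    (fun w hw => (h.hasFDerivAt w hw).hasFDerivWithinAt) h.norm_fderiv_le hw hw'

theorem exists_isRaySolution [CompleteSpace V] (h : IsControlledOn A B M D K) (ha : a ∈ B)
    (hu : u ∈ B) (v : V) : ∃ y : ℝ → V, y 0 = v ∧ IsRaySolution A a u y :=
  exists_linear_ode_solution
    ((h.continuousOn.comp (by fun_prop) fun _ => h.ray_mem ha hu).clm_apply continuousOn_const)
    (fun _ ht => h.norm_apply_sub_le (h.ray_mem ha hu ht) ha hu) v

end IsControlledOn

theorem IsRaySolution.eq_of_center (h : IsRaySolution A a a y) : y 1 = y 0 :=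
  constant_of_derivWithin_zero (fun t ht => (h t ht).differentiableWithinAt)
    (fun t ht => by
      have ht' := Ico_subset_Icc_self ht
      rw [(h t ht').derivWithin (uniqueDiffOn_Icc zero_lt_one t ht')]
      simp) 1 (by simp)

/-- The first order prediction `y t + A (a + t (u - a)) (t (u' - u)) (y t)`, made from a solution
`y` along the ray from `a` to `u`, of the solution along the ray from `a` to `u'`. -/
noncomputable def rayPrediction (A : E → E →L[ℝ] V →L[ℝ] V) (a u u' : E) (y : ℝ → V) (t : ℝ) : V :=
  y t + A (a + t • (u - a)) (t • (u' - u)) (y t)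

/-- The derivative of `rayPrediction` when `y` is a solution along the ray from `a` to `u`. -/
noncomputable def rayPredictionDeriv (A : E → E →L[ℝ] V →L[ℝ] V) (a u u' : E) (y : ℝ → V)
    (t : ℝ) : V :=
  A (a + t • (u - a)) (u - a) (y t)
    + ((fderiv ℝ A (a + t • (u - a)) (u - a) (t • (u' - u)) + A (a + t • (u - a)) (u' - u)) (y t)
      + A (a + t • (u - a)) (t • (u' - u)) (A (a + t • (u - a)) (u - a) (y t)))

theorem IsRaySolution.hasDerivWithinAt_rayPrediction (hy : IsRaySolution A a u y)
    (hA : HasFDerivAt A (fderiv ℝ A (a + t • (u - a))) (a + t • (u - a)))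
    (ht : t ∈ Icc (0 : ℝ) 1) :
    HasDerivWithinAt (rayPrediction A a u u' y) (rayPredictionDeriv A a u u' y t) (Icc 0 1) t := by
  have hAray : HasDerivAt (fun t : ℝ => A (a + t • (u - a))) _ t :=
    hA.comp_hasDerivAt t (hasDerivAt_ray a (u - a) t)
  have hsmul : HasDerivAt (fun t : ℝ => t • (u' - u)) (u' - u) t := by
    simpa using hasDerivAt_ray 0 (u' - u) t
  exact (hy t ht).add ((hAray.clm_apply hsmul).hasDerivWithinAt.clm_apply (hy t ht))

/-- Complete integrability cancels the terms of first order in `u' - u`. -/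
theorem IntegrableAt.defect_eq {w : E} (hw : IntegrableAt A w) (w' x h k : E) (z : V) :
    A w x z + ((fderiv ℝ A w x k + A w h) z + A w k (A w x z)) - A w' (x + h) (z + A w k z) =
      -((A w' - A w - fderiv ℝ A w k) (x + h) z) - fderiv ℝ A w k h z
        - (A w' - A w) (x + h) (A w k z) - A w h (A w k z) := by
  have hsymm : fderiv ℝ A w x k z + A w k (A w x z) = fderiv ℝ A w k x z + A w x (A w k z) :=
    congrArg (fun T : V →L[ℝ] V => T z) (hw x k)
  simp only [map_add, sub_apply, add_apply]
  linear_combination (norm := module) hsymm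

/-- The constant `C'` in the bound `C' ‖u' - u‖ ^ 2` for the failure of `rayPrediction`, made from a
solution bounded by `C`, to be a solution along the ray from `a` to `u'`. -/
def defectConst (M D K C : ℝ) : ℝ := (K * D + K + (M + K * D) * M) * C

theorem IsControlledOn.norm_defect_le (hB : IsControlledOn A B M D K) {w w' x h : E} {z : V}
    (hw : w ∈ B) (hw' : w' ∈ B) (hh : ‖w' - w‖ ≤ ‖h‖) (hxh : ‖x + h‖ ≤ D) (hz : ‖z‖ ≤ C) :
    ‖A w x z + ((fderiv ℝ A w x (w' - w) + A w h) z + A w (w' - w) (A w x z))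
      - A w' (x + h) (z + A w (w' - w) z)‖ ≤ defectConst M D K C * ‖h‖ ^ 2 := by
  have hK : 0 ≤ K := (norm_nonneg _).trans (hB.norm_fderiv_le w hw)
  have hAkz : ‖A w (w' - w) z‖ ≤ M * ‖h‖ * C :=
    (A w (w' - w)).le_of_opNorm_le_of_le ((A w).le_of_opNorm_le_of_le (hB.norm_le w hw) hh) hz
  have hTaylor : ‖(A w' - A w - fderiv ℝ A w (w' - w)) (x + h) z‖ ≤ K * ‖h‖ ^ 2 * D * C :=
    ContinuousLinearMap.le_of_opNorm_le_of_le _ (ContinuousLinearMap.le_of_opNorm_le_of_le _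
      ((hB.norm_taylor_le w hw w' hw').trans (by gcongr)) hxh) hz
  have hderiv : ‖fderiv ℝ A w (w' - w) h z‖ ≤ K * ‖h‖ * ‖h‖ * C :=
    ContinuousLinearMap.le_of_opNorm_le_of_le _ (ContinuousLinearMap.le_of_opNorm_le_of_le _
      ((fderiv ℝ A w).le_of_opNorm_le_of_le (hB.norm_fderiv_le w hw) hh) le_rfl) hz
  have hdiff : ‖(A w' - A w) (x + h) (A w (w' - w) z)‖ ≤ K * ‖h‖ * D * (M * ‖h‖ * C) :=
    ContinuousLinearMap.le_of_opNorm_le_of_le _ (ContinuousLinearMap.le_of_opNorm_le_of_le _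
      ((hB.norm_image_sub_le hw hw').trans (by gcongr)) hxh) hAkz
  have hsq : ‖A w h (A w (w' - w) z)‖ ≤ M * ‖h‖ * (M * ‖h‖ * C) :=
    (A w h).le_of_opNorm_le_of_le ((A w).le_of_opNorm_le_of_le (hB.norm_le w hw) le_rfl) hAkz
  rw [(hB.integrableAt w hw).defect_eq]
  refine (norm_sub_le_of_le (norm_sub_le_of_le (norm_sub_le_of_le
    ((norm_neg _).le.trans hTaylor) hderiv) hdiff) hsq).trans (le_of_eq ?_)
  rw [defectConst]
  ring

theorem IsControlledOn.dist_rayPredictionDeriv_le (hB : IsControlledOn A B M D K) (ha : a ∈ B)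
    (hu : u ∈ B) (hu' : u' ∈ B) (ht : t ∈ Icc (0 : ℝ) 1) (hC : ‖y t‖ ≤ C) :
    dist (rayPredictionDeriv A a u u' y t)
      (A (a + t • (u' - a)) (u' - a) (rayPrediction A a u u' y t)) ≤
        defectConst M D K C * ‖u' - u‖ ^ 2 := by
  have hk : a + t • (u' - a) - (a + t • (u - a)) = t • (u' - u) := by module
  have hx : u - a + (u' - u) = u' - a := by abel
  have hnorm : ‖t • (u' - u)‖ ≤ ‖u' - u‖ := by
    rw [norm_smul, Real.norm_of_nonneg ht.1]
    exact mul_le_of_le_one_left (norm_nonneg _) ht.2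
  have := hB.norm_defect_le (x := u - a) (h := u' - u) (hB.ray_mem ha hu ht) (hB.ray_mem ha hu' ht)
    (hk ▸ hnorm) (hx ▸ hB.norm_sub_le a ha u' hu') hC
  rwa [hk, hx, ← dist_eq_norm] at this

theorem IsControlledOn.norm_raySolution_sub_le (hB : IsControlledOn A B M D K) (ha : a ∈ B)
    (hu : u ∈ B) (hu' : u' ∈ B) (hy : IsRaySolution A a u y) (hy' : IsRaySolution A a u' y')
    (h0 : y' 0 = y 0) (hC : ∀ t ∈ Icc (0 : ℝ) 1, ‖y t‖ ≤ C) :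
    ‖y' 1 - y 1 - A u (u' - u) (y 1)‖ ≤
      gronwallBound 0 (1 / 2 : NNReal) (0 + defectConst M D K C * ‖u' - u‖ ^ 2) 1 := by
  have hIci : ∀ t ∈ Ico (0 : ℝ) 1, Icc (0 : ℝ) 1 ∈ 𝓝[Ici t] t := fun t ht =>
    mem_of_superset (Icc_mem_nhdsGE ht.2) (Icc_subset_Icc_left ht.1)
  have hlip : ∀ t ∈ Ico (0 : ℝ) 1,
      LipschitzOnWith (1 / 2) (fun z => A (a + t • (u' - a)) (u' - a) z) univ := fun t ht =>
    ((A (a + t • (u' - a)) (u' - a)).lipschitz.weaken (by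
      simpa [← NNReal.coe_le_coe] using hB.norm_apply_sub_le
        (hB.ray_mem ha hu' (Ico_subset_Icc_self ht)) ha hu')).lipschitzOnWith
  have hG : ∀ t ∈ Icc (0 : ℝ) 1, HasDerivWithinAt (rayPrediction A a u u' y)
      (rayPredictionDeriv A a u u' y t) (Icc 0 1) t := fun t ht =>
    hy.hasDerivWithinAt_rayPrediction (hB.hasFDerivAt _ (hB.ray_mem ha hu ht)) ht
  have hdist := dist_le_of_approx_trajectories_ODE_of_mem (δ := 0) (εf := 0) hlip
    (fun t ht => (hy' t ht).continuousWithinAt)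
    (fun t ht => (hy' t (Ico_subset_Icc_self ht)).mono_of_mem_nhdsWithin (hIci t ht))
    (fun t _ => (dist_self _).le) (fun _ _ => mem_univ _)
    (fun t ht => (hG t ht).continuousWithinAt)
    (fun t ht => (hG t (Ico_subset_Icc_self ht)).mono_of_mem_nhdsWithin (hIci t ht))
    (fun t ht => hB.dist_rayPredictionDeriv_le ha hu hu' (Ico_subset_Icc_self ht)
      (hC t (Ico_subset_Icc_self ht)))
    (fun _ _ => mem_univ _) (by simp [rayPrediction, h0]) 1 (by simp)
  rw [dist_eq_norm, rayPrediction, one_smul, one_smul, sub_zero, add_sub_cancel] at hdist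
  rwa [sub_sub]

theorem IsControlledOn.solvesAt (hB : IsControlledOn A B M D K) (ha : a ∈ B) {v : V}
    {y : E → ℝ → V} (hy0 : ∀ u ∈ B, y u 0 = v) (hy : ∀ u ∈ B, IsRaySolution A a u (y u))
    (hu : u ∈ B) : SolvesAt A (fun u => y u 1) u := by
  obtain ⟨C, hC⟩ := isCompact_Icc.exists_bound_of_continuousOn
    (fun t ht => (hy u hu t ht).continuousWithinAt : ContinuousOn (y u) (Icc 0 1))
  have hbigO : (fun u' => y u' 1 - y u 1 - A u (u' - u) (y u 1)) =O[𝓝 u]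
      fun u' => ‖u' - u‖ ^ 2 := by
    refine Asymptotics.IsBigO.of_bound
      (defectConst M D K C / (1 / 2) * (Real.exp (1 / 2) - 1)) ?_
    filter_upwards [hB.isOpen.mem_nhds hu] with u' hu'
    refine (hB.norm_raySolution_sub_le ha hu hu' (hy u hu) (hy u' hu')
      ((hy0 u' hu').trans (hy0 u hu).symm) hC).trans (le_of_eq ?_)
    rw [gronwallBound_of_K_ne_0 (by norm_num)]
    simp only [norm_pow, norm_norm, NNReal.coe_div, NNReal.coe_one, NNReal.coe_ofNat]
    ring_nf
  have hlittleO : (fun u' => ‖u' - u‖ ^ 2) =o[𝓝 u] fun u' => u' - u :=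
    (Asymptotics.isLittleO_norm_pow_id one_lt_two).comp_tendsto
      (tendsto_sub_nhds_zero_iff.2 tendsto_id)
  exact HasFDerivAt.of_isLittleO (hbigO.trans_isLittleO hlittleO)

theorem IsControlledOn.exists_solution [CompleteSpace V] (hB : IsControlledOn A B M D K)
    (ha : a ∈ B) (v : V) : ∃ Y : E → V, Y a = v ∧ ∀ u ∈ B, SolvesAt A Y u := by
  have hode : ∀ u ∈ B, ∃ y : ℝ → V, y 0 = v ∧ IsRaySolution A a u y := fun u hu =>
    hB.exists_isRaySolution ha hu v
  choose! y hy0 hy using hode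
  exact ⟨fun u => y u 1, (hy a ha).eq_of_center.trans (hy0 a ha),
    fun u hu => hB.solvesAt ha hy0 hy hu⟩

theorem norm_taylor_le_of_lipschitzOnWith {F : Type*} [NormedAddCommGroup F] [NormedSpace ℝ F]
    {f : E → F} {K : NNReal} (hB : Convex ℝ B) (hf : ∀ w ∈ B, HasFDerivAt f (fderiv ℝ f w) w)
    (hK : LipschitzOnWith K (fderiv ℝ f) B) {w w' : E} (hw : w ∈ B) (hw' : w' ∈ B) :
    ‖f w' - f w - fderiv ℝ f w (w' - w)‖ ≤ K * ‖w' - w‖ ^ 2 := by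
  have hsub : segment ℝ w w' ⊆ B := hB.segment_subset hw hw'
  rw [sq, ← mul_assoc]
  refine Convex.norm_image_sub_le_of_norm_hasFDerivWithin_le' (s := segment ℝ w w')
    (fun z hz => (hf z (hsub hz)).hasFDerivWithinAt) (fun z hz => ?_)
    (convex_segment _ _) (left_mem_segment _ _ _) (right_mem_segment _ _ _)
  refine (hK.norm_sub_le (hsub hz) hw).trans ?_
  gcongr
  exact norm_sub_le_of_mem_segment hz

theorem exists_ball_isControlledOn {U : Set E} (hU : IsOpen U) (hA : ContDiffOn ℝ ∞ A U)
    (hint : ∀ u ∈ U, IntegrableAt A u) (hu : u ∈ U) :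
    ∃ ρ > 0, ball u ρ ⊆ U ∧ ∃ M D K, IsControlledOn A (ball u ρ) M D K := by
  have hAu : ContDiffAt ℝ ∞ A u := hA.contDiffAt (hU.mem_nhds hu)
  have hAu' : ContDiffAt ℝ 1 (fderiv ℝ A) u := hAu.fderiv_right (by norm_cast)
  obtain ⟨K, s, hs, hKs⟩ := hAu'.exists_lipschitzOnWith
  have hbound : ∀ᶠ w in 𝓝 u, ‖A w‖ ≤ ‖A u‖ + 1 :=
    (hAu.continuousAt.norm.eventually_lt_const (lt_add_one _)).mono fun _ h => h.le
  have hbound' : ∀ᶠ w in 𝓝 u, ‖fderiv ℝ A w‖ ≤ ‖fderiv ℝ A u‖ + 1 :=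
    (hAu'.continuousAt.norm.eventually_lt_const (lt_add_one _)).mono fun _ h => h.le
  obtain ⟨R, hR, h⟩ := Metric.eventually_nhds_iff_ball.1
    (((hbound.and hbound').and hs).and (hU.mem_nhds hu))
  set M := ‖A u‖ + 1
  have : 0 < M := by positivity
  set ρ := min R (1 / (4 * M))
  have hρR : ball u ρ ⊆ ball u R := ball_subset_ball (min_le_left _ _)
  have hdiff : ∀ w ∈ ball u ρ, HasFDerivAt A (fderiv ℝ A w) w := fun w hw =>
    ((hA.contDiffAt (hU.mem_nhds (h w (hρR hw)).2)).differentiableAt (by simp)).hasFDerivAt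
  refine ⟨ρ, lt_min hR (by positivity), fun w hw => (h w (hρR hw)).2, M, 2 * ρ,
    max K (‖fderiv ℝ A u‖ + 1), isOpen_ball, convex_ball _ _, hdiff,
    fun w hw => hint w (h w (hρR hw)).2, fun w hw => (h w (hρR hw)).1.1.1,
    fun w hw => (h w (hρR hw)).1.1.2.trans (le_max_right _ _), fun w hw w' hw' => ?_,
    fun w hw w' hw' => ?_, ?_⟩
  · refine (norm_taylor_le_of_lipschitzOnWith (convex_ball _ _) hdiff
      (hKs.mono fun w hw => (h w (hρR hw)).1.2) hw hw').trans ?_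
    gcongr
    exact le_max_left _ _
  · rw [← dist_eq_norm, two_mul]
    exact (dist_triangle_right _ _ u).trans (add_le_add (mem_ball.1 hw').le (mem_ball.1 hw).le)
  · have : ρ ≤ 1 / (4 * M) := min_le_right _ _
    rw [le_div_iff₀ (by positivity)] at this
    linarith

theorem exists_ball_solutions [CompleteSpace V] {U : Set E} (hU : IsOpen U)
    (hA : ContDiffOn ℝ ∞ A U) (hint : ∀ u ∈ U, IntegrableAt A u) (hu : u ∈ U) :
    ∃ ρ > 0, ball u ρ ⊆ U ∧ ∀ a ∈ ball u ρ, ∀ v : V,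
      ∃ Y : E → V, Y a = v ∧ ∀ w ∈ ball u ρ, SolvesAt A Y w := by
  obtain ⟨ρ, hρ, hρU, M, D, K, hB⟩ := exists_ball_isControlledOn hU hA hint hu
  exact ⟨ρ, hρ, hρU, fun a ha v => hB.exists_solution ha v⟩

end LocalExistence

section GlobalExistence

variable {E V : Type*} [NormedAddCommGroup E] [NormedSpace ℝ E]
  [NormedAddCommGroup V] [NormedSpace ℝ V]

/-- The values of type `V` with the discrete topology: the sheets of `LeafSpace A U` over a small
ball are indexed by them. -/
structure DiscreteValue (V : Type*) where
  val : V

instance (V : Type*) : TopologicalSpace (DiscreteValue V) := ⊥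

instance (V : Type*) : DiscreteTopology (DiscreteValue V) := ⟨rfl⟩

/-- The space `E × V` with the topology whose leaves over `U` are the graphs of the local
solutions of the system `dY = A Y`. -/
@[ext]
structure LeafSpace (A : E → E →L[ℝ] V →L[ℝ] V) (U : Set E) where
  pt : E
  val : V

variable {A : E → E →L[ℝ] V →L[ℝ] V} {U B : Set E} {Y : E → V}

namespace LeafSpace

instance : TopologicalSpace (LeafSpace A U) where
  IsOpen W := ∀ z ∈ W, z.pt ∈ U → ∀ Y : E → V, (∀ᶠ u in 𝓝 z.pt, SolvesAt A Y u) →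
    Y z.pt = z.val → ∀ᶠ u in 𝓝 z.pt, (⟨u, Y u⟩ : LeafSpace A U) ∈ W
  isOpen_univ := fun _ _ _ _ _ _ => Eventually.of_forall fun _ => mem_univ _
  isOpen_inter := fun _ _ h h' z hz hU Y hY hv =>
    (h z hz.1 hU Y hY hv).and (h' z hz.2 hU Y hY hv)
  isOpen_sUnion := fun _ hS z ⟨W, hW, hz⟩ hU Y hY hv =>
    (hS W hW z hz hU Y hY hv).mono fun _ h => ⟨W, hW, h⟩

theorem continuous_pt : Continuous (pt : LeafSpace A U → E) :=
  ⟨fun _ hB _ hz _ _ _ _ => hB.mem_nhds hz⟩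

theorem isOpen_graph (hU : IsOpen U) (hA : ContinuousOn A U) (hB : IsOpen B)
    (hY : ∀ u ∈ B, SolvesAt A Y u) :
    IsOpen {z : LeafSpace A U | z.pt ∈ B ∧ Y z.pt = z.val} := by
  rintro z ⟨hzB, hz⟩ hzU Z hZ hZz
  filter_upwards [hB.mem_nhds hzB, SolvesAt.eventuallyEq hU hA hzU
    (eventually_of_mem (hB.mem_nhds hzB) hY) hZ (hz.trans hZz.symm)] with u hu hu' using ⟨hu, hu'⟩

theorem continuous_section (hB : IsOpen B) (hBU : B ⊆ U) (hY : ∀ u ∈ B, SolvesAt A Y u) :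
    Continuous fun u : B => (⟨u, Y u⟩ : LeafSpace A U) := by
  refine continuous_def.2 fun W hW => isOpen_iff_mem_nhds.2 fun u hu => ?_
  exact continuous_subtype_val.continuousAt.eventually
    (hW _ hu (hBU u.2) Y (eventually_of_mem (hB.mem_nhds u.2) hY) rfl)

/-- Over `B`, the leaf space is a product, by the family `S` of the solutions of the system on `B`
parametrized by their values at a fixed point. -/
noncomputable def homeomorphProd (hU : IsOpen U) (hA : ContinuousOn A U) (hB : IsOpen B)
    (hBU : B ⊆ U) (S : V → E → V) (hS : ∀ v, ∀ u ∈ B, SolvesAt A (S v) u)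
    (hbij : ∀ u ∈ B, Function.Bijective fun v => S v u) :
    (pt ⁻¹' B : Set (LeafSpace A U)) ≃ₜ B × DiscreteValue V where
  toFun z := (⟨z.1.pt, z.2⟩, ⟨(Equiv.ofBijective _ (hbij _ z.2)).symm z.1.val⟩)
  invFun x := ⟨⟨x.1, S x.2.val x.1⟩, x.1.2⟩
  left_inv z := by
    ext1
    exact congrArg (mk _) ((Equiv.ofBijective _ (hbij _ z.2)).apply_symm_apply _)
  right_inv x := by
    ext1
    · rfl
    · exact congrArg DiscreteValue.mk ((Equiv.ofBijective _ (hbij _ x.1.2)).symm_apply_apply _)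
  continuous_toFun := by
    refine ((continuous_pt.comp continuous_subtype_val).subtype_mk _).prodMk
      (continuous_discrete_rng.2 fun ⟨v⟩ => ?_)
    convert (isOpen_graph hU hA hB (hS v)).preimage continuous_subtype_val using 1
    ext ⟨z, hz⟩
    change (⟨_⟩ : DiscreteValue V) = ⟨v⟩ ↔ z.pt ∈ B ∧ S v z.pt = z.val
    rw [DiscreteValue.mk.injEq, Equiv.symm_apply_eq, eq_comm]
    exact (and_iff_right hz).symm
  continuous_invFun := by
    refine Continuous.subtype_mk (continuous_prod_of_discrete_right.2 fun v => ?_) _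
    exact continuous_section hB hBU (hS v.val)

end LeafSpace

theorem exists_solution_family (hB : Convex ℝ B) (hA : ContinuousOn A B)
    (hsol : ∀ a ∈ B, ∀ v : V, ∃ Y : E → V, Y a = v ∧ ∀ u ∈ B, SolvesAt A Y u)
    {u₀ : E} (hu₀ : u₀ ∈ B) :
    ∃ S : V → E → V, (∀ v, ∀ u ∈ B, SolvesAt A (S v) u) ∧
      ∀ u ∈ B, Function.Bijective fun v => S v u := by
  choose! S hS₀ hS using hsol u₀ hu₀
  refine ⟨S, hS, fun u hu => ⟨fun v w hvw => ?_, fun v => ?_⟩⟩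
  · rw [← hS₀ v, ← hS₀ w]
    exact SolvesAt.eqOn_of_convex hB hA (hS v) (hS w) hu hvw hu₀
  · obtain ⟨Y, hYu, hY⟩ := hsol u hu v
    exact ⟨Y u₀, (SolvesAt.eqOn_of_convex hB hA (hS _) hY hu₀ (hS₀ _) hu).trans hYu⟩

theorem LeafSpace.isCoveringMapOn (hU : IsOpen U) (hA : ContinuousOn A U)
    (hloc : ∀ u₀ ∈ U, ∃ ρ > 0, ball u₀ ρ ⊆ U ∧ ∀ a ∈ ball u₀ ρ, ∀ v : V,
      ∃ Y : E → V, Y a = v ∧ ∀ u ∈ ball u₀ ρ, SolvesAt A Y u) :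
    IsCoveringMapOn (LeafSpace.pt : LeafSpace A U → E) U := by
  intro u₀ hu₀
  obtain ⟨ρ, hρ, hBU, hsol⟩ := hloc u₀ hu₀
  obtain ⟨S, hS, hbij⟩ := exists_solution_family (convex_ball u₀ ρ) (hA.mono hBU) hsol
    (mem_ball_self hρ)
  exact IsEvenlyCovered.to_isEvenlyCovered_preimage (I := DiscreteValue V)
    ⟨inferInstance, ball u₀ ρ, mem_ball_self hρ, isOpen_ball, isOpen_ball.preimage continuous_pt,
      homeomorphProd hU hA isOpen_ball hBU S hS hbij, fun _ => rfl⟩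

theorem LeafSpace.solvesAt_of_continuous_section (hU : IsOpen U) (hA : ContinuousOn A U)
    (hF : Continuous fun u : U => (⟨u, Y u⟩ : LeafSpace A U)) {u : E} (hu : u ∈ U) {Z : E → V}
    (hB : B ∈ 𝓝 u) (hBo : IsOpen B) (hZ : ∀ w ∈ B, SolvesAt A Z w) (hZu : Z u = Y u) :
    SolvesAt A Y u := by
  have huB : u ∈ B := mem_of_mem_nhds hB
  have hgraph := (isOpen_graph hU hA hBo hZ).preimage hF
  have heq : Y =ᶠ[𝓝 u] Z := by
    filter_upwards [(hU.isOpenMap_subtype_val _ hgraph).mem_nhds ⟨⟨u, hu⟩, ⟨huB, hZu⟩, rfl⟩]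
    rintro _ ⟨w, ⟨-, hw⟩, rfl⟩
    exact hw.symm
  unfold SolvesAt
  rw [← hZu]
  exact HasFDerivAt.congr_of_eventuallyEq (hZ u huB) heq

/-- The projection of the leaf space to `U` is a covering map, so that the inclusion of a simply
connected `U` lifts to it. -/
theorem exists_solution_of_isSimplyConnected [CompleteSpace V] (hU : IsOpen U)
    (hUs : IsSimplyConnected U) (hA : ContDiffOn ℝ ∞ A U) (hint : ∀ u ∈ U, IntegrableAt A u)
    {u₀ : E} (hu₀ : u₀ ∈ U) (v₀ : V) :
    ∃ Y : E → V, Y u₀ = v₀ ∧ ContDiffOn ℝ ∞ Y U ∧ ∀ u ∈ U, SolvesAt A Y u := by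
  classical
  have hloc := fun u (hu : u ∈ U) => exists_ball_solutions hU hA hint hu
  have := hUs.simplyConnectedSpace
  have := hU.locallyPathConnectedSpace
  obtain ⟨F, ⟨hF₀, hF⟩, -⟩ :=
    (LeafSpace.isCoveringMapOn hU hA.continuousOn hloc).existsUnique_continuousMap_lifts
    (⟨Subtype.val, continuous_subtype_val⟩ : C(U, E)) (a₀ := ⟨u₀, hu₀⟩) (e₀ := ⟨u₀, v₀⟩) rfl
    (fun a => a.2)
  let Y : E → V := fun u => if hu : u ∈ U then (F ⟨u, hu⟩).val else 0
  have hYF : (fun u : U => (⟨u, Y u⟩ : LeafSpace A U)) = F := by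
    funext u
    exact LeafSpace.ext (congrFun hF u).symm (by simp [Y])
  have hY : ∀ u ∈ U, SolvesAt A Y u := fun u hu => by
    obtain ⟨ρ, hρ, -, hsol⟩ := hloc u hu
    obtain ⟨Z, hZu, hZ⟩ := hsol u (mem_ball_self hρ) (Y u)
    exact LeafSpace.solvesAt_of_continuous_section hU hA.continuousOn (hYF ▸ F.continuous) hu
      (ball_mem_nhds u hρ) isOpen_ball hZ hZu
  exact ⟨Y, by simp [Y, hu₀, hF₀], SolvesAt.contDiffOn hU hA hY, hY⟩

end GlobalExistence

section PartialDerivatives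

variable {N : ℕ} {E : Type} [NormedAddCommGroup E] [NormedSpace ℝ E]
  {U : Set (Fin N → ℝ)} {u : Fin N → ℝ} {f g : (Fin N → ℝ) → E} {i j : Fin N}

theorem differentiableAt_of_contDiffOn (hU : IsOpen U) (hf : ContDiffOn ℝ ∞ f U) (hu : u ∈ U) :
    DifferentiableAt ℝ f u :=
  (hf.contDiffAt (hU.mem_nhds hu)).differentiableAt (by simp)

theorem contDiffOn_pd (hU : IsOpen U) (hf : ContDiffOn ℝ ∞ f U) (i : Fin N) :
    ContDiffOn ℝ ∞ (pd i f) U :=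
  (hf.fderiv_of_isOpen hU (by simp)).clm_apply contDiffOn_const

theorem pd_congr (hU : IsOpen U) (h : EqOn f g U) (hu : u ∈ U) : pd i f u = pd i g u := by
  have hfg : f =ᶠ[𝓝 u] g := eventually_of_mem (hU.mem_nhds hu) h
  simp only [pd, hfg.fderiv_eq]

theorem fderiv_eq_sum_pd (f : (Fin N → ℝ) → E) (u x : Fin N → ℝ) :
    fderiv ℝ f u x = ∑ i, x i • pd i f u := by
  conv_lhs => rw [pi_eq_sum_univ' x]
  simp only [map_sum, map_smul, pd]

theorem pd_comm (hU : IsOpen U) (hf : ContDiffOn ℝ ∞ f U) (hu : u ∈ U) :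
    pd i (pd j f) u = pd j (pd i f) u := by
  have hfu : ContDiffAt ℝ ∞ f u := hf.contDiffAt (hU.mem_nhds hu)
  have hd : DifferentiableAt ℝ (fderiv ℝ f) u :=
    (hfu.fderiv_right (m := 1) (by norm_cast)).differentiableAt (by simp)
  have h : ∀ k l : Fin N, pd k (pd l f) u =
      fderiv ℝ (fderiv ℝ f) u (Pi.single k 1) (Pi.single l 1) := fun k l => by
    unfold pd
    rw [fderiv_clm_apply hd (differentiableAt_const _)]
    simp
  rw [h, h]
  exact (hfu.isSymmSndFDerivAt (by simp; norm_cast)).eq _ _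

theorem pd_add (hf : DifferentiableAt ℝ f u) (hg : DifferentiableAt ℝ g u) :
    pd i (fun v => f v + g v) u = pd i f u + pd i g u := by
  simp [pd, fderiv_fun_add hf hg]

theorem pd_const (c : E) : pd i (fun _ : Fin N → ℝ => c) u = 0 := by
  simp [pd]

theorem pd_sum {κ : Type*} {s : Finset κ} {f : κ → (Fin N → ℝ) → E}
    (hf : ∀ k ∈ s, DifferentiableAt ℝ (f k) u) :
    pd i (fun v => ∑ k ∈ s, f k v) u = ∑ k ∈ s, pd i (f k) u := by
  simp [pd, fderiv_fun_sum hf]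

theorem pd_clm {F : Type} [NormedAddCommGroup F] [NormedSpace ℝ F] (T : E →L[ℝ] F)
    (hf : DifferentiableAt ℝ f u) : pd i (fun v => T (f v)) u = T (pd i f u) :=
  congrArg (fun S : (Fin N → ℝ) →L[ℝ] F => S (Pi.single i 1))
    (T.hasFDerivAt.comp u hf.hasFDerivAt).fderiv

theorem pd_bilin {F G : Type} [NormedAddCommGroup F] [NormedSpace ℝ F] [NormedAddCommGroup G]
    [NormedSpace ℝ G] (B : E →L[ℝ] F →L[ℝ] G) {g : (Fin N → ℝ) → F} (hf : DifferentiableAt ℝ f u)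
    (hg : DifferentiableAt ℝ g u) :
    pd i (fun v => B (f v) (g v)) u = B (pd i f u) (g u) + B (f u) (pd i g u) := by
  rw [pd, (B.hasFDerivAt_of_bilinear hf.hasFDerivAt hg.hasFDerivAt).fderiv, add_comm]
  rfl

theorem pd_apply {κ : Type} [Fintype κ] {f : (Fin N → ℝ) → κ → ℝ}
    (hf : DifferentiableAt ℝ f u) (e : κ) : pd i f u e = pd i (fun v => f v e) u :=
  (pd_clm (ContinuousLinearMap.proj (R := ℝ) (φ := fun _ : κ => ℝ) e) hf).symm

theorem exists_eqOn_add_const_of_pd_eq (hU : IsOpen U) (hc : IsPreconnected U)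
    (hf : ∀ u ∈ U, DifferentiableAt ℝ f u) (hg : ∀ u ∈ U, DifferentiableAt ℝ g u)
    (h : ∀ u ∈ U, ∀ i, pd i g u = pd i f u) : ∃ c, ∀ u ∈ U, g u = f u + c := by
  obtain ⟨c, hc⟩ := hU.exists_eq_add_of_fderiv_eq (𝕜 := ℝ) hc
    (fun u hu => (hg u hu).differentiableWithinAt) (fun u hu => (hf u hu).differentiableWithinAt)
    (fun u hu => by
      ext x
      simp only [fderiv_eq_sum_pd, h u hu])
  exact ⟨c, hc⟩

end PartialDerivatives

section Systems

set_option maxSynthPendingDepth 6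

variable {N : ℕ} {V W : Type} [NormedAddCommGroup V] [NormedSpace ℝ V]
  [NormedAddCommGroup W] [NormedSpace ℝ W] {U : Set (Fin N → ℝ)} {u u₀ : Fin N → ℝ}
  {a : Fin N → (Fin N → ℝ) → W}

/-- The one-form `Σᵢ aᵢ duⁱ` with values in `W`. -/
noncomputable def oneForm (a : Fin N → (Fin N → ℝ) → W) (u : Fin N → ℝ) : (Fin N → ℝ) →L[ℝ] W :=
  ∑ i, (ContinuousLinearMap.smulRightL ℝ (Fin N → ℝ) W (ContinuousLinearMap.proj i)) (a i u)

theorem oneForm_apply (x : Fin N → ℝ) : oneForm a u x = ∑ i, x i • a i u := by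
  simp [oneForm]

theorem contDiffOn_oneForm (ha : ∀ i, ContDiffOn ℝ ∞ (a i) U) : ContDiffOn ℝ ∞ (oneForm a) U :=
  ContDiffOn.sum fun i _ => contDiffOn_const.clm_apply (ha i)

theorem pd_oneForm (ha : ∀ i, DifferentiableAt ℝ (a i) u) (j : Fin N) :
    pd j (oneForm a) u = oneForm (fun i => pd j (a i)) u :=
  (pd_sum fun i _ => (ContinuousLinearMap.differentiableAt _).comp u (ha i)).trans
    (Finset.sum_congr rfl fun i _ => pd_clm _ (ha i))

theorem integrableAt_comp_oneForm {B : W →L[ℝ] V →L[ℝ] V}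
    (ha : ∀ i, DifferentiableAt ℝ (a i) u)
    (h : ∀ i j, B (pd j (a i) u) + (B (a i u)).comp (B (a j u)) =
      B (pd i (a j) u) + (B (a j u)).comp (B (a i u))) :
    IntegrableAt (fun u => B.comp (oneForm a u)) u := by
  have hdiff : DifferentiableAt ℝ (oneForm a) u :=
    DifferentiableAt.fun_sum fun i _ => (ContinuousLinearMap.differentiableAt _).comp u (ha i)
  have hexpand : ∀ x y : Fin N → ℝ, fderiv ℝ (fun u => B.comp (oneForm a u)) u x y
      + (B.comp (oneForm a u) y).comp (B.comp (oneForm a u) x) =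
        ∑ j, ∑ i, (x j * y i) • (B (pd j (a i) u) + (B (a i u)).comp (B (a j u))) := by
    intro x y
    have hpd : ∀ j, pd j (fun u => B.comp (oneForm a u)) u
        = B.comp (oneForm (fun i => pd j (a i)) u) := fun j => by
      rw [← pd_oneForm ha]
      exact pd_clm (ContinuousLinearMap.compL ℝ (Fin N → ℝ) W (V →L[ℝ] V) B) hdiff
    ext v
    simp only [fderiv_eq_sum_pd, hpd, ContinuousLinearMap.comp_apply, oneForm_apply, add_apply,
      sum_apply, smul_apply, map_sum, map_smul, smul_add, Finset.sum_add_distrib, Finset.smul_sum,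
      smul_smul]
  intro x y
  rw [hexpand, hexpand, Finset.sum_comm]
  simp only [h, mul_comm]

theorem exists_pd_eq_clm_apply [CompleteSpace V] (hU : IsOpen U) (hUs : IsSimplyConnected U)
    (B : W →L[ℝ] V →L[ℝ] V) (ha : ∀ i, ContDiffOn ℝ ∞ (a i) U)
    (h : ∀ u ∈ U, ∀ i j, B (pd j (a i) u) + (B (a i u)).comp (B (a j u)) =
      B (pd i (a j) u) + (B (a j u)).comp (B (a i u))) (hu₀ : u₀ ∈ U) (v₀ : V) :
    ∃ Y : (Fin N → ℝ) → V, Y u₀ = v₀ ∧ ContDiffOn ℝ ∞ Y U ∧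
      ∀ u ∈ U, ∀ i, pd i Y u = B (a i u) (Y u) := by
  obtain ⟨Y, hY₀, hY, hsol⟩ := exists_solution_of_isSimplyConnected hU hUs
    (contDiffOn_const.clm_comp (contDiffOn_oneForm ha)) (fun u hu => integrableAt_comp_oneForm
      (fun i => differentiableAt_of_contDiffOn hU (ha i) hu) (h u hu)) hu₀ v₀
  refine ⟨Y, hY₀, hY, fun u hu i => ?_⟩
  rw [pd, HasFDerivAt.fderiv (hsol u hu)]
  simp [oneForm_apply, Pi.single_apply]

/-- The Poincaré lemma for one-forms: `(1, ψ)` solves a linear system. -/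
theorem exists_potential [CompleteSpace W] (hU : IsOpen U) (hUs : IsSimplyConnected U)
    (ha : ∀ i, ContDiffOn ℝ ∞ (a i) U) (h : ∀ u ∈ U, ∀ i j, pd j (a i) u = pd i (a j) u) :
    ∃ ψ : (Fin N → ℝ) → W, ContDiffOn ℝ ∞ ψ U ∧ ∀ u ∈ U, ∀ i, pd i ψ u = a i u := by
  obtain ⟨u₀, hu₀⟩ := hUs.nonempty
  let B : W →L[ℝ] (ℝ × W) →L[ℝ] (ℝ × W) :=
    (ContinuousLinearMap.smulRightL ℝ (ℝ × W) (ℝ × W) (ContinuousLinearMap.fst ℝ ℝ W)).comp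
      (ContinuousLinearMap.inr ℝ ℝ W)
  have hB : ∀ w z, B w z = (0, z.1 • w) := fun w z => by simp [B]
  obtain ⟨Y, hY₀, hY, hpd⟩ := exists_pd_eq_clm_apply hU hUs B ha (fun u hu i j => by
    ext z <;> simp [hB, h u hu i j]) hu₀ (1, 0)
  have hYd : ∀ u ∈ U, DifferentiableAt ℝ Y u := fun u => differentiableAt_of_contDiffOn hU hY
  obtain ⟨c, hc⟩ := exists_eqOn_add_const_of_pd_eq (f := fun _ => (0 : ℝ)) hU
    hUs.isPathConnected.isConnected.isPreconnected (fun u _ => differentiableAt_const _)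
    (fun u hu => (hYd u hu).fst) fun u hu i => by
      refine (pd_clm (ContinuousLinearMap.fst ℝ ℝ W) (hYd u hu)).trans ?_
      rw [hpd u hu, hB, pd_const]
      rfl
  have hfst : ∀ u ∈ U, (Y u).1 = 1 := fun u hu => by
    rw [hc u hu, ← hc u₀ hu₀, hY₀]
  refine ⟨fun u => (Y u).2, contDiff_snd.comp_contDiffOn hY, fun u hu i => ?_⟩
  refine (pd_clm (ContinuousLinearMap.snd ℝ ℝ W) (hYd u hu)).trans ?_
  rw [hpd u hu, hB, hfst u hu, one_smul]
  rfl

end Systems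

section Hessian

variable {N : ℕ} {U : Set (Fin N → ℝ)} {u : Fin N → ℝ} {f g : (Fin N → ℝ) → ℝ}

theorem contDiffOn_hessian (hU : IsOpen U) (hf : ContDiffOn ℝ ∞ f U) (i j : Fin N) :
    ContDiffOn ℝ ∞ (fun u => hessian f u i j) U :=
  contDiffOn_pd hU (contDiffOn_pd hU hf i) j

theorem hessian_symm (hU : IsOpen U) (hf : ContDiffOn ℝ ∞ f U) (hu : u ∈ U) (i j : Fin N) :
    hessian f u i j = hessian f u j i :=
  pd_comm hU hf hu

theorem exists_hessian_eq {H : Fin N → Fin N → (Fin N → ℝ) → ℝ} (hU : IsOpen U)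
    (hUs : IsSimplyConnected U) (hH : ∀ i j, ContDiffOn ℝ ∞ (H i j) U)
    (hsymm : ∀ u ∈ U, ∀ i j, H i j u = H j i u)
    (hpd : ∀ u ∈ U, ∀ i j k, pd k (H i j) u = pd j (H i k) u) :
    ∃ ψ : (Fin N → ℝ) → ℝ, ContDiffOn ℝ ∞ ψ U ∧ ∀ u ∈ U, ∀ i j, hessian ψ u i j = H i j u := by
  choose f hf hfH using fun i =>
    exists_potential hU hUs (hH i) (fun u hu j k => hpd u hu i j k)
  obtain ⟨ψ, hψ, hψf⟩ := exists_potential hU hUs hf (fun u hu i j => by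
    rw [hfH i u hu j, hfH j u hu i, hsymm u hu])
  exact ⟨ψ, hψ, fun u hu i j =>
    (pd_congr hU (fun v hv => hψf v hv i) hu).trans (hfH i u hu j)⟩

theorem pd_add_dotProduct (hf : DifferentiableAt ℝ f u) (a : Fin N → ℝ) (i : Fin N) :
    pd i (fun v => f v + a ⬝ᵥ v) u = pd i f u + a i := by
  have ha : HasFDerivAt (fun v : Fin N → ℝ => a ⬝ᵥ v)
      (LinearMap.toContinuousLinearMap (dotProductBilin ℝ ℝ a)) u :=
    (LinearMap.toContinuousLinearMap (dotProductBilin ℝ ℝ a)).hasFDerivAt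
  rw [pd_add hf ha.differentiableAt]
  simp [pd, ha.fderiv]

theorem hessian_add_affine (hU : IsOpen U) (hf : ContDiffOn ℝ ∞ f U) (hu : u ∈ U)
    (a : Fin N → ℝ) (c : ℝ) : hessian (fun v => f v + a ⬝ᵥ v + c) u = hessian f u := by
  have hpd : ∀ i, EqOn (pd i fun v => f v + a ⬝ᵥ v + c) (fun v => pd i f v + a i) U :=
    fun i v hv => by
      have hfv := differentiableAt_of_contDiffOn hU hf hv
      rw [pd_add (by unfold dotProduct; fun_prop) (by fun_prop), pd_const, add_zero,
        pd_add_dotProduct hfv]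
  ext i j
  refine (pd_congr hU (hpd i) hu).trans ?_
  rw [pd_add (differentiableAt_of_contDiffOn hU (contDiffOn_pd hU hf i) hu)
    (differentiableAt_const _), pd_const, add_zero]
  rfl

theorem exists_eqOn_add_affine (hU : IsOpen U) (hc : IsPreconnected U) (hf : ContDiffOn ℝ ∞ f U)
    (hg : ContDiffOn ℝ ∞ g U) (h : ∀ u ∈ U, hessian g u = hessian f u) :
    ∃ (a : Fin N → ℝ) (c : ℝ), ∀ u ∈ U, g u = f u + a ⬝ᵥ u + c := by
  have hd : ∀ {f : (Fin N → ℝ) → ℝ}, ContDiffOn ℝ ∞ f U → ∀ u ∈ U, DifferentiableAt ℝ f u :=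
    fun hf u => differentiableAt_of_contDiffOn hU hf
  choose a ha using fun i => exists_eqOn_add_const_of_pd_eq hU hc (hd (contDiffOn_pd hU hf i))
    (hd (contDiffOn_pd hU hg i)) fun u hu j => congrFun (congrFun (h u hu) i) j
  exact ⟨a, exists_eqOn_add_const_of_pd_eq hU hc
    (fun u hu => (hd hf u hu).add (by unfold dotProduct; fun_prop)) (hd hg)
    fun u hu i => (ha i u hu).trans (pd_add_dotProduct (hd hf u hu) a i).symm⟩

end Hessian

section MatrixCalculus

open scoped Matrix Matrix.Norms.Operator

variable {N : ℕ} {l m n o : Type} [Fintype l] [Fintype m] [Fintype n] [Fintype o]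
  {U : Set (Fin N → ℝ)} {u : Fin N → ℝ} {i : Fin N}

/-- Matrix multiplication as a continuous bilinear map, for the calculus of matrix-valued
functions. -/
noncomputable def matrixMulCLM : Matrix l m ℝ →L[ℝ] Matrix m n ℝ →L[ℝ] Matrix l n ℝ :=
  IsBilinearMap.toContinuousBilinearMap (f := fun A B => A * B)
    { add_left := Matrix.add_mul
      add_right := Matrix.mul_add
      smul_left := Matrix.smul_mul
      smul_right := fun c A B => Matrix.mul_smul A c B }

theorem contDiffOn_matrix_iff {M : (Fin N → ℝ) → Matrix m n ℝ} :
    ContDiffOn ℝ ∞ M U ↔ ∀ a b, ContDiffOn ℝ ∞ (fun u => M u a b) U := by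
  rw [← (Matrix.ofLinearEquiv ℝ).symm.toContinuousLinearEquiv.comp_contDiffOn_iff,
    contDiffOn_pi]
  exact forall_congr' fun a => contDiffOn_pi

theorem pd_matrix_apply {M : (Fin N → ℝ) → Matrix m n ℝ} (hM : DifferentiableAt ℝ M u)
    (a : m) (b : n) : pd i M u a b = pd i (fun v => M v a b) u :=
  (pd_clm (LinearMap.toContinuousLinearMap (Matrix.entryLinearMap ℝ ℝ a b)) hM).symm

theorem contDiffOn_matrix_mul {M : (Fin N → ℝ) → Matrix l m ℝ} {M' : (Fin N → ℝ) → Matrix m n ℝ}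
    (hM : ContDiffOn ℝ ∞ M U) (hM' : ContDiffOn ℝ ∞ M' U) :
    ContDiffOn ℝ ∞ (fun u => M u * M' u) U :=
  (matrixMulCLM (l := l) (m := m) (n := n)).isBoundedBilinearMap.contDiff.comp_contDiffOn
    (hM.prodMk hM')

theorem pd_matrix_mul {M : (Fin N → ℝ) → Matrix l m ℝ} {M' : (Fin N → ℝ) → Matrix m n ℝ}
    (hM : DifferentiableAt ℝ M u) (hM' : DifferentiableAt ℝ M' u) :
    pd i (fun v => M v * M' v) u = pd i M u * M' u + M u * pd i M' u :=
  pd_bilin matrixMulCLM hM hM'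

theorem pd_transpose {M : (Fin N → ℝ) → Matrix m n ℝ} (hM : DifferentiableAt ℝ M u) :
    pd i (fun v => (M v)ᵀ) u = (pd i M u)ᵀ :=
  pd_clm (LinearMap.toContinuousLinearMap (Matrix.transposeLinearEquiv m n ℝ ℝ).toLinearMap) hM

theorem contDiffOn_transpose {M : (Fin N → ℝ) → Matrix m n ℝ} (hM : ContDiffOn ℝ ∞ M U) :
    ContDiffOn ℝ ∞ (fun u => (M u)ᵀ) U :=
  (LinearMap.toContinuousLinearMap
    (Matrix.transposeLinearEquiv m n ℝ ℝ).toLinearMap).contDiff.comp_contDiffOn hM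

/-- The columns of `M` are parallel sections on `U` of the connection with matrices `aᵢ`. -/
def IsParallel (U : Set (Fin N → ℝ)) (a : Fin N → (Fin N → ℝ) → Matrix m m ℝ)
    (M : (Fin N → ℝ) → Matrix m n ℝ) : Prop :=
  ContDiffOn ℝ ∞ M U ∧ ∀ u ∈ U, ∀ i, pd i M u = a i u * M u

/-- The connection with matrices `aᵢ` is flat on `U`: the system `∂ᵢ Y = aᵢ Y` is completely
integrable. -/
def HasZeroCurvature (U : Set (Fin N → ℝ)) (a : Fin N → (Fin N → ℝ) → Matrix m m ℝ) : Prop :=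
  ∀ u ∈ U, ∀ i j, pd j (a i) u + a i u * a j u = pd i (a j) u + a j u * a i u

theorem HasZeroCurvature.exists_isParallel {a : Fin N → (Fin N → ℝ) → Matrix m m ℝ}
    (h : HasZeroCurvature U a) (hU : IsOpen U) (hUs : IsSimplyConnected U)
    (ha : ∀ i, ContDiffOn ℝ ∞ (a i) U) {u₀ : Fin N → ℝ} (hu₀ : u₀ ∈ U) (M₀ : Matrix m n ℝ) :
    ∃ M, M u₀ = M₀ ∧ IsParallel U a M := by
  have : CompleteSpace (Matrix m n ℝ) := FiniteDimensional.complete ℝ _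
  refine exists_pd_eq_clm_apply hU hUs matrixMulCLM ha (fun u hu i j => ?_) hu₀ M₀
  refine ContinuousLinearMap.ext fun M => ?_
  change pd j (a i) u * M + a i u * (a j u * M) = pd i (a j) u * M + a j u * (a i u * M)
  rw [← Matrix.mul_assoc, ← Matrix.add_mul, h u hu i j, Matrix.add_mul, Matrix.mul_assoc]

theorem IsParallel.hasZeroCurvature [DecidableEq m]
    {a : Fin N → (Fin N → ℝ) → Matrix m m ℝ}
    {M : (Fin N → ℝ) → Matrix m n ℝ} {M' : (Fin N → ℝ) → Matrix n m ℝ} (hM : IsParallel U a M)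
    (hU : IsOpen U) (ha : ∀ i, ContDiffOn ℝ ∞ (a i) U) (hM' : ∀ u ∈ U, M u * M' u = 1) :
    HasZeroCurvature U a := by
  intro u hu i j
  have hpd : ∀ i j, pd j (pd i M) u = (pd j (a i) u + a i u * a j u) * M u := fun i j => by
    rw [pd_congr (g := fun v => a i v * M v) hU (fun v hv => hM.2 v hv i) hu,
      pd_matrix_mul (differentiableAt_of_contDiffOn hU (ha i) hu)
        (differentiableAt_of_contDiffOn hU hM.1 hu), hM.2 u hu, Matrix.add_mul, Matrix.mul_assoc]
  have h : (pd j (a i) u + a i u * a j u) * M u = (pd i (a j) u + a j u * a i u) * M u := by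
    rw [← hpd, ← hpd, pd_comm hU hM.1 hu]
  simpa only [Matrix.mul_assoc, hM' u hu, Matrix.mul_one] using congrArg (· * M' u) h

variable [DecidableEq m]

theorem contDiffOn_matrix_inv {G : (Fin N → ℝ) → Matrix m m ℝ} (hG : ContDiffOn ℝ ∞ G U)
    (hdet : ∀ u ∈ U, (G u).det ≠ 0) : ContDiffOn ℝ ∞ (fun u => (G u)⁻¹) U := by
  have : CompleteSpace (Matrix m m ℝ) := FiniteDimensional.complete ℝ _
  intro u hu
  simp only [Matrix.nonsing_inv_eq_ringInverse]
  obtain ⟨x, hx⟩ := (Matrix.isUnit_iff_isUnit_det _).2 (hdet u hu).isUnit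
  have hinv : ContDiffAt ℝ ∞ Ring.inverse (G u) := hx ▸ contDiffAt_ringInverse ℝ x
  exact hinv.comp_contDiffWithinAt u (hG u hu)

theorem pd_matrix_inv {G : (Fin N → ℝ) → Matrix m m ℝ} (hU : IsOpen U)
    (hG : ContDiffOn ℝ ∞ G U) (hdet : ∀ u ∈ U, (G u).det ≠ 0) (hu : u ∈ U) :
    pd i (fun v => (G v)⁻¹) u = -((G u)⁻¹ * pd i G u * (G u)⁻¹) := by
  have hinv : ∀ v ∈ U, (G v)⁻¹ * G v = 1 := fun v hv =>
    Matrix.nonsing_inv_mul _ (hdet v hv).isUnit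
  have h := pd_matrix_mul (i := i)
    (differentiableAt_of_contDiffOn hU (contDiffOn_matrix_inv hG hdet) hu)
    (differentiableAt_of_contDiffOn hU hG hu)
  rw [pd_congr (g := fun _ => 1) hU hinv hu, pd_const] at h
  have h' := congrArg (· * (G u)⁻¹) h
  simp only [zero_mul, add_mul] at h'
  rw [mul_assoc _ (G u), Matrix.mul_nonsing_inv _ (hdet u hu).isUnit, mul_one] at h'
  exact eq_neg_of_add_eq_zero_left h'.symm

/-- The connection with matrices `aᵢ` preserves on `U` the scalar product whose Gram matrix is
`G⁻¹`; equivalently, `G` is a parallel bivector. -/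
def PreservesMetric (U : Set (Fin N → ℝ)) (a : Fin N → (Fin N → ℝ) → Matrix m m ℝ)
    (G : (Fin N → ℝ) → Matrix m m ℝ) : Prop :=
  ContDiffOn ℝ ∞ G U ∧ (∀ u ∈ U, (G u).det ≠ 0) ∧
    ∀ u ∈ U, ∀ i, pd i G u = a i u * G u + G u * (a i u)ᵀ

theorem PreservesMetric.pd_inv {a : Fin N → (Fin N → ℝ) → Matrix m m ℝ}
    {G : (Fin N → ℝ) → Matrix m m ℝ} (hG : PreservesMetric U a G) (hU : IsOpen U) (hu : u ∈ U) :
    pd i (fun v => (G v)⁻¹) u = -((G u)⁻¹ * a i u + (a i u)ᵀ * (G u)⁻¹) := by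
  obtain ⟨hGs, hdet, hGa⟩ := hG
  rw [pd_matrix_inv hU hGs hdet hu, hGa u hu, mul_add, add_mul, ← mul_assoc (G u)⁻¹ (G u),
    Matrix.nonsing_inv_mul _ (hdet u hu).isUnit, one_mul, mul_assoc _ _ (G u)⁻¹,
    mul_assoc _ (G u), Matrix.mul_nonsing_inv _ (hdet u hu).isUnit, mul_one]

theorem PreservesMetric.exists_transpose_mul_inv_mul_eq
    {a : Fin N → (Fin N → ℝ) → Matrix m m ℝ} {G : (Fin N → ℝ) → Matrix m m ℝ}
    {M : (Fin N → ℝ) → Matrix m n ℝ} {M' : (Fin N → ℝ) → Matrix m o ℝ}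
    (hG : PreservesMetric U a G) (hU : IsOpen U) (hc : IsPreconnected U) (hM : IsParallel U a M)
    (hM' : IsParallel U a M') : ∃ P, ∀ u ∈ U, (M u)ᵀ * (G u)⁻¹ * M' u = P := by
  have hinv := contDiffOn_matrix_inv hG.1 hG.2.1
  have hMG := contDiffOn_matrix_mul (contDiffOn_transpose hM.1) hinv
  obtain ⟨P, hP⟩ := exists_eqOn_add_const_of_pd_eq (f := fun _ => 0)
    (g := fun u => (M u)ᵀ * (G u)⁻¹ * M' u) hU hc
    (fun u _ => differentiableAt_const _)
    (fun u => differentiableAt_of_contDiffOn hU (contDiffOn_matrix_mul hMG hM'.1))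
    fun u hu i => by
      have hd {p q : Type} [Fintype p] [Fintype q] {F : (Fin N → ℝ) → Matrix p q ℝ}
        (hF : ContDiffOn ℝ ∞ F U) := differentiableAt_of_contDiffOn hU hF hu
      rw [pd_const, pd_matrix_mul (hd hMG) (hd hM'.1),
        pd_matrix_mul (hd (contDiffOn_transpose hM.1)) (hd hinv), pd_transpose (hd hM.1),
        hG.pd_inv hU hu, hM.2 u hu, hM'.2 u hu]
      simp only [Matrix.transpose_mul, Matrix.mul_add, Matrix.add_mul, Matrix.mul_neg, neg_add,
        Matrix.neg_mul, Matrix.mul_assoc]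
      abel
  exact ⟨P, fun u hu => (hP u hu).trans (zero_add P)⟩

end MatrixCalculus

section FrameConnection

open scoped Matrix Matrix.Norms.Operator

variable {N : ℕ} {ι κ : Type} [Fintype ι] [Fintype κ] [DecidableEq ι] [DecidableEq κ]
  {U : Set (Fin N → ℝ)} {η : Matrix ι ι ℝ} {μ : Matrix κ κ ℝ}

/-- The matrix of the derivative of an adapted frame (tangent vectors with Gram matrix `η`, normal
vectors with Gram matrix `μ`) in a given direction, as a function of the matrix `W` of the second
fundamental forms: `W i α` is the `α`-th second fundamental form of the given direction and the
`i`-th one. The diagonal blocks vanish because the coordinates are flat and there is no torsion. -/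
noncomputable def frameConnection (η : Matrix ι ι ℝ) (μ : Matrix κ κ ℝ) :
    Matrix ι κ ℝ →ₗ[ℝ] Matrix (ι ⊕ κ) (ι ⊕ κ) ℝ where
  toFun W := Matrix.fromBlocks 0 (W * μ⁻¹) (-(Wᵀ * η⁻¹)) 0
  map_add' W W' := by
    simp [Matrix.fromBlocks_add, Matrix.add_mul, add_comm]
  map_smul' c W := by
    simp [Matrix.fromBlocks_smul]

theorem frameConnection_apply (W : Matrix ι κ ℝ) :
    frameConnection η μ W = Matrix.fromBlocks 0 (W * μ⁻¹) (-(Wᵀ * η⁻¹)) 0 := rfl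

theorem det_fromBlocks_ne_zero_iff :
    (Matrix.fromBlocks η 0 0 μ).det ≠ 0 ↔ η.det ≠ 0 ∧ μ.det ≠ 0 := by
  rw [Matrix.det_fromBlocks_zero₂₁, mul_ne_zero_iff]

theorem frameConnection_mul_fromBlocks (hη : η.det ≠ 0) (hμ : μ.det ≠ 0) (W : Matrix ι κ ℝ) :
    frameConnection η μ W * Matrix.fromBlocks η 0 0 μ = Matrix.fromBlocks 0 W (-Wᵀ) 0 := by
  rw [frameConnection_apply, Matrix.fromBlocks_multiply]
  simp [Matrix.mul_assoc, Matrix.nonsing_inv_mul _ hη.isUnit, Matrix.nonsing_inv_mul _ hμ.isUnit]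

theorem contDiffOn_frameConnection {Ω : Fin N → (Fin N → ℝ) → Matrix ι κ ℝ}
    (hΩ : ∀ k, ContDiffOn ℝ ∞ (Ω k) U) (k : Fin N) :
    ContDiffOn ℝ ∞ (fun u => frameConnection η μ (Ω k u)) U :=
  (LinearMap.toContinuousLinearMap (frameConnection η μ)).contDiff.comp_contDiffOn (hΩ k)

theorem preservesMetric_frameConnection (hηs : η.IsSymm) (hμs : μ.IsSymm) (hη : η.det ≠ 0)
    (hμ : μ.det ≠ 0) (Ω : Fin N → (Fin N → ℝ) → Matrix ι κ ℝ) :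
    PreservesMetric U (fun k u => frameConnection η μ (Ω k u))
      (fun _ => Matrix.fromBlocks η 0 0 μ) := by
  refine ⟨contDiffOn_const, fun _ _ => det_fromBlocks_ne_zero_iff.2 ⟨hη, hμ⟩, fun u _ k => ?_⟩
  have hG : (Matrix.fromBlocks η 0 0 μ)ᵀ = Matrix.fromBlocks η 0 0 μ := by
    simp [Matrix.fromBlocks_transpose, hηs.eq, hμs.eq]
  have hskew : Matrix.fromBlocks η 0 0 μ * (frameConnection η μ (Ω k u))ᵀ =
      (frameConnection η μ (Ω k u) * Matrix.fromBlocks η 0 0 μ)ᵀ := by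
    rw [Matrix.transpose_mul, hG]
  rw [pd_const, hskew, frameConnection_mul_fromBlocks hη hμ, Matrix.fromBlocks_transpose,
    Matrix.fromBlocks_add]
  simp

theorem matrix_mul_inv_inj {o : Type} (hη : η.det ≠ 0) {X Y : Matrix o ι ℝ} :
    X * η⁻¹ = Y * η⁻¹ ↔ X = Y :=
  (Matrix.mul_left_injective_of_inv η⁻¹ η (Matrix.nonsing_inv_mul _ hη.isUnit)).eq_iff

theorem frameConnection_add_mul_eq_iff (hη : η.det ≠ 0) (hμ : μ.det ≠ 0)
    (W W' D D' : Matrix ι κ ℝ) :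
    frameConnection η μ D + frameConnection η μ W * frameConnection η μ W' =
        frameConnection η μ D' + frameConnection η μ W' * frameConnection η μ W ↔
      D = D' ∧ W * μ⁻¹ * W'ᵀ = W' * μ⁻¹ * Wᵀ ∧ Wᵀ * η⁻¹ * W' = W'ᵀ * η⁻¹ * W := by
  simp only [frameConnection_apply, Matrix.fromBlocks_multiply, Matrix.fromBlocks_add,
    Matrix.fromBlocks_inj, Matrix.zero_mul, Matrix.mul_zero, Matrix.mul_neg, Matrix.neg_mul,
    add_zero, zero_add, neg_zero, neg_inj, ← Matrix.mul_assoc, matrix_mul_inv_inj hη,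
    matrix_mul_inv_inj hμ, Matrix.transpose_inj]
  tauto

/-- The Codazzi, Gauss and Ricci equations are the three blocks of the curvature of the frame
connection. -/
theorem hasZeroCurvature_frameConnection_iff {Ω : Fin N → (Fin N → ℝ) → Matrix ι κ ℝ}
    (hη : η.det ≠ 0) (hμ : μ.det ≠ 0) (hΩ : ∀ u ∈ U, ∀ k, DifferentiableAt ℝ (Ω k) u) :
    HasZeroCurvature U (fun k u => frameConnection η μ (Ω k u)) ↔
      ∀ u ∈ U, ∀ i j, pd j (Ω i) u = pd i (Ω j) u ∧
        Ω i u * μ⁻¹ * (Ω j u)ᵀ = Ω j u * μ⁻¹ * (Ω i u)ᵀ ∧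
        (Ω i u)ᵀ * η⁻¹ * Ω j u = (Ω j u)ᵀ * η⁻¹ * Ω i u := by
  refine forall₄_congr fun u hu i j => ?_
  have hpd : ∀ i j, pd j (fun u => frameConnection η μ (Ω i u)) u =
      frameConnection η μ (pd j (Ω i) u) := fun i j =>
    pd_clm (LinearMap.toContinuousLinearMap (frameConnection η μ)) (hΩ u hu i)
  rw [hpd, hpd]
  exact frameConnection_add_mul_eq_iff hη hμ _ _ _ _

end FrameConnection

section Signature

open QuadraticMap QuadraticForm
open scoped Matrix

theorem ncard_setOf_sumElim {κ κ' : Type*} [Finite κ] [Finite κ'] (w : κ → ℝ) (w' : κ' → ℝ)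
    (P : ℝ → Prop) :
    {i | P (Sum.elim w w' i)}.ncard = {i | P (w i)}.ncard + {i | P (w' i)}.ncard := by
  have hunion : {i | P (Sum.elim w w' i)} =
      Sum.inl '' {i | P (w i)} ∪ Sum.inr '' {i | P (w' i)} := by
    ext (i | i) <;> simp
  have hdisj : Disjoint (Sum.inl '' {i | P (w i)} : Set (κ ⊕ κ')) (Sum.inr '' {i | P (w' i)}) :=
    isCompl_range_inl_range_inr.disjoint.mono (image_subset_range _ _) (image_subset_range _ _)
  rw [hunion, ncard_union_eq hdisj, ncard_image_of_injective _ Sum.inl_injective,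
    ncard_image_of_injective _ Sum.inr_injective]

theorem weightedSumSquares_prod_equivalent {κ κ' : Type*} [Fintype κ] [Fintype κ'] (w : κ → ℝ)
    (w' : κ' → ℝ) : Equivalent ((weightedSumSquares ℝ w).prod (weightedSumSquares ℝ w'))
      (weightedSumSquares ℝ (Sum.elim w w')) :=
  ⟨{ (LinearEquiv.sumArrowLequivProdArrow κ κ' ℝ ℝ).symm with
    map_app' := fun x => by
      simp [weightedSumSquares_apply, LinearEquiv.sumArrowLequivProdArrow]
      rfl }⟩

theorem sig_prod {M M' : Type*} [AddCommGroup M] [Module ℝ M] [FiniteDimensional ℝ M]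
    [AddCommGroup M'] [Module ℝ M'] [FiniteDimensional ℝ M'] (Q : QuadraticForm ℝ M)
    (Q' : QuadraticForm ℝ M') :
    sigPos (Q.prod Q') = sigPos Q + sigPos Q' ∧ sigNeg (Q.prod Q') = sigNeg Q + sigNeg Q' := by
  have : Invertible (2 : ℝ) := invertibleOfNonzero two_ne_zero
  obtain ⟨w, ⟨e⟩⟩ := Q.equivalent_weightedSumSquares
  obtain ⟨w', ⟨e'⟩⟩ := Q'.equivalent_weightedSumSquares
  have h : Equivalent (Q.prod Q') (weightedSumSquares ℝ (Sum.elim w w')) :=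
    Equivalent.trans ⟨e.prod e'⟩ (weightedSumSquares_prod_equivalent w w')
  rw [sigPos_of_equiv_weightedSumSquares h, sigNeg_of_equiv_weightedSumSquares h,
    sigPos_of_equiv_weightedSumSquares ⟨e⟩, sigNeg_of_equiv_weightedSumSquares ⟨e⟩,
    sigPos_of_equiv_weightedSumSquares ⟨e'⟩, sigNeg_of_equiv_weightedSumSquares ⟨e'⟩]
  exact ⟨ncard_setOf_sumElim w w' (fun x => 0 < x), ncard_setOf_sumElim w w' (fun x => x < 0)⟩

/-- The weights of the standard quadratic form of signature `(p, q)`. -/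
def pseudoWeights (p q : ℕ) : Fin p ⊕ Fin q → ℝ := Sum.elim (fun _ => 1) (fun _ => -1)

/-- The Gram matrix of the standard basis of the pseudo-Euclidean space of signature `(p, q)`. -/
abbrev pseudoGram (p q : ℕ) : Matrix (Fin p ⊕ Fin q) (Fin p ⊕ Fin q) ℝ :=
  Matrix.diagonal (pseudoWeights p q)

variable {p q : ℕ}

theorem sigPos_weightedSumSquares_pseudoWeights :
    sigPos (weightedSumSquares ℝ (pseudoWeights p q)) = p := by
  rw [sigPos_weightedSumSquares]
  refine (ncard_setOf_sumElim _ _ (fun x => 0 < x)).trans ?_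
  norm_num [ncard_univ]

theorem sigNeg_weightedSumSquares_pseudoWeights :
    sigNeg (weightedSumSquares ℝ (pseudoWeights p q)) = q := by
  rw [sigNeg_weightedSumSquares]
  refine (ncard_setOf_sumElim _ _ (fun x => x < 0)).trans ?_
  norm_num [ncard_univ]

theorem equivalent_weightedSumSquares_of_equiv {κ κ' : Type*} [Fintype κ] [Fintype κ'] {w : κ → ℝ}
    {w' : κ' → ℝ} (σ : κ' ≃ κ) (hσ : ∀ k, w (σ k) = w' k) :
    Equivalent (weightedSumSquares ℝ w) (weightedSumSquares ℝ w') :=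
  ⟨{ LinearEquiv.funCongrLeft ℝ ℝ σ with
    map_app' := fun x => by
      simp only [weightedSumSquares_apply, ← hσ]
      exact σ.sum_comp fun k => w k • (x k * x k) }⟩

theorem equivalent_pseudoWeights {κ : Type*} [Fintype κ] {w : κ → ℝ}
    (hw : ∀ k, w k = -1 ∨ w k = 1) (hp : {k | 0 < w k}.ncard = p) (hq : {k | w k < 0}.ncard = q) :
    Equivalent (weightedSumSquares ℝ w) (weightedSumSquares ℝ (pseudoWeights p q)) := by
  classical
  have hneg : {k | ¬ 0 < w k} = {k | w k < 0} := by
    ext k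
    rcases hw k with h | h <;> norm_num [h]
  let σ₁ : {k // 0 < w k} ≃ Fin p := Finite.equivFinOfCardEq hp
  let σ₂ : {k // ¬ 0 < w k} ≃ Fin q := Finite.equivFinOfCardEq (hneg ▸ hq :)
  refine equivalent_weightedSumSquares_of_equiv
    ((Equiv.sumCongr σ₁.symm σ₂.symm).trans (Equiv.sumCompl _)) ?_
  rintro (a | c)
  · have h : 0 < w (σ₁.symm a) := (σ₁.symm a).2
    exact (hw (σ₁.symm a)).resolve_left fun h' => by linarith
  · have h : ¬ 0 < w (σ₂.symm c) := (σ₂.symm c).2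
    exact (hw (σ₂.symm c)).resolve_right fun h' => by linarith

variable {ι κ : Type} [Fintype ι] [Fintype κ] [DecidableEq ι] [DecidableEq κ]
  {A : Matrix ι ι ℝ} {B : Matrix κ κ ℝ}

theorem toQuadraticForm'_apply (A : Matrix ι ι ℝ) (x : ι → ℝ) :
    A.toQuadraticForm' x = x ⬝ᵥ A *ᵥ x :=
  Matrix.toLinearMap₂'_apply' A x x

theorem toQuadraticForm'_mul_mul_transpose (M : Matrix ι κ ℝ) (B : Matrix κ κ ℝ) (x : ι → ℝ) :
    (M * B * Mᵀ).toQuadraticForm' x = B.toQuadraticForm' (x ᵥ* M) := by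
  rw [toQuadraticForm'_apply, toQuadraticForm'_apply, ← Matrix.mulVec_mulVec,
    ← Matrix.mulVec_mulVec, Matrix.mulVec_transpose, Matrix.dotProduct_mulVec]

theorem toQuadraticForm'_diagonal (w : ι → ℝ) :
    (Matrix.diagonal w).toQuadraticForm' = weightedSumSquares ℝ w := by
  ext x
  rw [toQuadraticForm'_apply, weightedSumSquares_apply]
  simp only [dotProduct, Matrix.mulVec_diagonal, smul_eq_mul, mul_left_comm]

theorem toQuadraticForm'_fromBlocks_equivalent (A : Matrix ι ι ℝ) (B : Matrix κ κ ℝ) :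
    Equivalent (Matrix.fromBlocks A 0 0 B).toQuadraticForm'
      (A.toQuadraticForm'.prod B.toQuadraticForm') :=
  ⟨{ LinearEquiv.sumArrowLequivProdArrow ι κ ℝ ℝ with
    map_app' := fun x => by
      simp only [toQuadraticForm'_apply, Matrix.fromBlocks_mulVec, QuadraticMap.prod_apply,
        Matrix.zero_mulVec, add_zero, zero_add, dotProduct, Fintype.sum_sum_type]
      rfl }⟩

theorem associated_toQuadraticForm' (hA : A.IsSymm) :
    associated (R := ℝ) A.toQuadraticForm' = Matrix.toLinearMap₂' ℝ A := by
  refine associated_left_inverse ℝ fun x y => ?_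
  rw [Matrix.toLinearMap₂'_apply', Matrix.toLinearMap₂'_apply', Matrix.dotProduct_mulVec,
      ← Matrix.mulVec_transpose, hA.eq, dotProduct_comm]

theorem toMatrix'_toQuadraticForm' (hA : A.IsSymm) : A.toQuadraticForm'.toMatrix' = A := by
  rw [QuadraticForm.toMatrix', associated_toQuadraticForm' hA, LinearMap.toMatrix'_toLinearMap₂']

theorem exists_mul_pseudoGram_mul_transpose_eq (hA : A.IsSymm) (hdet : A.det ≠ 0)
    (hp : p = sigPos A.toQuadraticForm') (hq : q = sigNeg A.toQuadraticForm') :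
    ∃ M : Matrix ι (Fin p ⊕ Fin q) ℝ, M * pseudoGram p q * Mᵀ = A := by
  have hsep : (associated (R := ℝ) A.toQuadraticForm').SeparatingLeft := by
    rw [associated_toQuadraticForm' hA]
    exact LinearMap.separatingLeft_toLinearMap₂'_of_det_ne_zero' hdet
  obtain ⟨w, hw, h⟩ := A.toQuadraticForm'.equivalent_one_neg_one_weighted_sum_squared hsep
  obtain ⟨Φ⟩ := h.trans (equivalent_pseudoWeights hw
    (hp.trans (sigPos_of_equiv_weightedSumSquares h)).symm
    (hq.trans (sigNeg_of_equiv_weightedSumSquares h)).symm)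
  have hcomp : A.toQuadraticForm' =
      (pseudoGram p q).toQuadraticForm'.comp Φ.toLinearEquiv.toLinearMap := by
    ext x
    rw [toQuadraticForm'_diagonal]
    exact (Φ.map_app x).symm
  refine ⟨(LinearMap.toMatrix' Φ.toLinearEquiv.toLinearMap)ᵀ, ?_⟩
  conv_rhs => rw [← toMatrix'_toQuadraticForm' hA, hcomp, QuadraticForm.toMatrix'_comp,
    toMatrix'_toQuadraticForm' (Matrix.isSymm_diagonal _)]
  rw [Matrix.transpose_transpose]

theorem toQuadraticForm'_equivalent_of_mul_diagonal_mul_transpose {w : κ → ℝ} {M : Matrix ι κ ℝ}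
    {M' : Matrix κ ι ℝ} (hM : M * M' = 1) (hM' : M' * M = 1)
    (h : M * Matrix.diagonal w * Mᵀ = A) :
    Equivalent A.toQuadraticForm' (weightedSumSquares ℝ w) :=
  ⟨{ Matrix.toLinearEquivRight'OfInv hM' hM with
    map_app' := fun x => by
      rw [← h, toQuadraticForm'_mul_mul_transpose, toQuadraticForm'_diagonal]
      rfl }⟩

variable {N L : ℕ} {η : Matrix (Fin N) (Fin N) ℝ} {μ : Matrix (Fin L) (Fin L) ℝ}

theorem signatureSum_iff : SignatureSum p q η μ ↔
    p = sigPos (Matrix.fromBlocks η 0 0 μ).toQuadraticForm' ∧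
      q = sigNeg (Matrix.fromBlocks η 0 0 μ).toQuadraticForm' := by
  have h := toQuadraticForm'_fromBlocks_equivalent η μ
  rw [h.sigPos_eq, h.sigNeg_eq, (sig_prod _ _).1, (sig_prod _ _).2, SignatureSum]

end Signature

section GramMatrix

open scoped Matrix

theorem pseudoGram_mul_self (p q : ℕ) : pseudoGram p q * pseudoGram p q = 1 := by
  rw [Matrix.diagonal_mul_diagonal, ← Matrix.diagonal_one]
  congr 1
  ext (a | b) <;> simp [pseudoWeights]

theorem pseudoInner_eq_dotProduct {p q : ℕ} (x y : PseudoE p q) :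
    pseudoInner x y = x ⬝ᵥ pseudoGram p q *ᵥ y := by
  simp [pseudoInner, dotProduct, Matrix.mulVec_diagonal, pseudoWeights, sub_eq_add_neg]

theorem pseudoInner_comm {p q : ℕ} (x y : PseudoE p q) : pseudoInner x y = pseudoInner y x := by
  simp only [pseudoInner, mul_comm]

theorem contDiffOn_pseudoInner {N p q : ℕ} {U : Set (Fin N → ℝ)}
    {x y : (Fin N → ℝ) → PseudoE p q} (hx : ContDiffOn ℝ ∞ x U) (hy : ContDiffOn ℝ ∞ y U) :
    ContDiffOn ℝ ∞ (fun u => pseudoInner (x u) (y u)) U :=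
  (ContDiffOn.sum fun a _ => (contDiffOn_pi.1 hx (.inl a)).mul (contDiffOn_pi.1 hy (.inl a))).sub
    (ContDiffOn.sum fun b _ => (contDiffOn_pi.1 hx (.inr b)).mul (contDiffOn_pi.1 hy (.inr b)))

theorem mul_pseudoGram_mul_transpose_apply {p q : ℕ} {m n : Type}
    (M : Matrix m (Fin p ⊕ Fin q) ℝ) (M' : Matrix n (Fin p ⊕ Fin q) ℝ) (a : m) (b : n) :
    (M * pseudoGram p q * M'ᵀ) a b = pseudoInner (M a) (M' b) := by
  rw [Matrix.mul_assoc, Matrix.mul_apply', pseudoInner_eq_dotProduct]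
  rfl

variable {m n : Type} [Fintype m] [Fintype n] [DecidableEq m]
  {M X : Matrix m n ℝ} {D : Matrix n n ℝ} {G a : Matrix m m ℝ}

theorem mul_eq_one_of_mul_mul_transpose_eq (hG : G.det ≠ 0) (h : M * D * Mᵀ = G) :
    M * (D * Mᵀ * G⁻¹) = 1 := by
  rw [← Matrix.mul_assoc, ← Matrix.mul_assoc, h, Matrix.mul_nonsing_inv _ hG.isUnit]

theorem linearIndependent_of_det_ne_zero (hG : G.det ≠ 0) (h : M * D * Mᵀ = G) :
    LinearIndependent ℝ M.row := by
  refine Matrix.vecMul_injective_iff.1 (Function.LeftInverse.injective (g := fun w =>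
    w ᵥ* (D * Mᵀ * G⁻¹)) fun v => ?_)
  change v ᵥ* M ᵥ* (D * Mᵀ * G⁻¹) = v
  rw [Matrix.vecMul_vecMul, mul_eq_one_of_mul_mul_transpose_eq hG h, Matrix.vecMul_one]

theorem mul_mul_transpose_injective (hcard : Fintype.card m = Fintype.card n) (hG : G.det ≠ 0)
    (h : M * D * Mᵀ = G) :
    Function.Injective fun Q : Matrix n n ℝ => M * Q * Mᵀ := by
  classical
  have hinv : D * Mᵀ * G⁻¹ * M = 1 := (Matrix.mul_eq_one_comm_of_card_eq _ _ _ hcard).1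
    (mul_eq_one_of_mul_mul_transpose_eq hG h)
  have hinv' : Mᵀ * (D * Mᵀ * G⁻¹)ᵀ = 1 := by
    rw [← Matrix.transpose_mul, hinv, Matrix.transpose_one]
  exact (Matrix.mul_left_injective_of_inv _ _ hinv').comp
    (Matrix.mul_right_injective_of_inv _ _ hinv)

variable [DecidableEq n]

theorem mul_mul_transpose_eq_iff (hcard : Fintype.card m = Fintype.card n) (hD : D * D = 1)
    (hG : G.det ≠ 0) : M * D * Mᵀ = G ↔ Mᵀ * G⁻¹ * M = D := by
  have hcomm : M * (D * Mᵀ * G⁻¹) = 1 ↔ D * Mᵀ * G⁻¹ * M = 1 :=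
    Matrix.mul_eq_one_comm_of_card_eq _ _ _ hcard
  have hleft : M * D * Mᵀ = G ↔ M * (D * Mᵀ * G⁻¹) = 1 := by
    refine ⟨mul_eq_one_of_mul_mul_transpose_eq hG, fun h => ?_⟩
    rw [← Matrix.mul_one (M * D * Mᵀ), ← Matrix.nonsing_inv_mul _ hG.isUnit, ← Matrix.mul_assoc,
      Matrix.mul_assoc M, Matrix.mul_assoc M, h, Matrix.one_mul]
  have hright : D * Mᵀ * G⁻¹ * M = 1 ↔ Mᵀ * G⁻¹ * M = D := by
    rw [← (Matrix.mul_right_injective_of_inv D D hD).eq_iff]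
    simp only [← Matrix.mul_assoc, hD, Matrix.one_mul, Matrix.mul_one]
  rw [hleft, hcomm, hright]

theorem eq_mul_iff_mul_mul_transpose_eq (hcard : Fintype.card m = Fintype.card n)
    (hD : D * D = 1) (hG : G.det ≠ 0) (h : M * D * Mᵀ = G) :
    X = a * M ↔ X * D * Mᵀ = a * G := by
  constructor
  · rintro rfl
    rw [Matrix.mul_assoc, Matrix.mul_assoc, ← Matrix.mul_assoc M, h]
  · intro hX
    calc X = X * D * (Mᵀ * G⁻¹ * M) := by
          rw [(mul_mul_transpose_eq_iff hcard hD hG).1 h, Matrix.mul_assoc, hD, Matrix.mul_one]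
      _ = X * D * Mᵀ * G⁻¹ * M := by simp only [Matrix.mul_assoc]
      _ = a * M := by rw [hX, Matrix.mul_assoc a, Matrix.mul_nonsing_inv _ hG.isUnit,
          Matrix.mul_one]

theorem det_ne_zero_of_linearIndependent (hcard : Fintype.card m = Fintype.card n)
    (hD : D * D = 1) (hM : LinearIndependent ℝ M.row) (h : M * D * Mᵀ = G) : G.det ≠ 0 := by
  have hsurj : Function.Surjective M.vecMulLinear :=
    (LinearMap.injective_iff_surjective_of_finrank_eq_finrank (by simpa using hcard)).1
      (Matrix.vecMul_injective_iff.2 hM)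
  obtain ⟨M', hM'⟩ := Matrix.vecMul_surjective_iff_exists_left_inverse.1 hsurj
  have hMM' : M * M' = 1 := (Matrix.mul_eq_one_comm_of_card_eq _ _ _ hcard).2 hM'
  refine Matrix.det_ne_zero_of_right_inverse (B := M'ᵀ * D * M') ?_
  calc G * (M'ᵀ * D * M') = M * D * (M' * M)ᵀ * D * M' := by
        rw [← h, Matrix.transpose_mul]
        simp only [Matrix.mul_assoc]
    _ = 1 := by rw [hM', Matrix.transpose_one, Matrix.mul_one, Matrix.mul_assoc M, hD,
        Matrix.mul_one, hMM']

end GramMatrix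

section Frames

open scoped Matrix Matrix.Norms.Operator

variable {N L p q : ℕ} {U : Set (Fin N → ℝ)} {u : Fin N → ℝ} {η : Matrix (Fin N) (Fin N) ℝ}
  {μ : Matrix (Fin L) (Fin L) ℝ} {r : (Fin N → ℝ) → PseudoE p q}
  {n : Fin L → (Fin N → ℝ) → PseudoE p q} {φ : Fin L → (Fin N → ℝ) → Matrix (Fin N) (Fin N) ℝ}

/-- The frame `(r_{u¹}, …, r_{uᴺ}, n_1, …, n_L)`, written as a matrix with these rows. -/
noncomputable def frame (r : (Fin N → ℝ) → PseudoE p q) (n : Fin L → (Fin N → ℝ) → PseudoE p q)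
    (u : Fin N → ℝ) : Matrix (Fin N ⊕ Fin L) (Fin p ⊕ Fin q) ℝ :=
  Matrix.of (Sum.elim (fun i => pd i r u) (fun α => n α u))

/-- The components `φ_{α,ik}`, for a fixed direction `k`, of the quadratic forms `φ_α` as a matrix
with rows `i` and columns `α`. -/
def slice (φ : Fin L → (Fin N → ℝ) → Matrix (Fin N) (Fin N) ℝ) (k : Fin N) (u : Fin N → ℝ) :
    Matrix (Fin N) (Fin L) ℝ :=
  Matrix.of fun i α => φ α u i k

theorem contDiffOn_slice (hφ : ∀ α i j, ContDiffOn ℝ ∞ (fun u => φ α u i j) U) (k : Fin N) :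
    ContDiffOn ℝ ∞ (slice φ k) U :=
  contDiffOn_matrix_iff.2 fun i α => hφ α i k

theorem contDiffOn_frame (hU : IsOpen U) (hr : ContDiffOn ℝ ∞ r U)
    (hn : ∀ α, ContDiffOn ℝ ∞ (n α) U) : ContDiffOn ℝ ∞ (frame r n) U :=
  contDiffOn_matrix_iff.2 fun
    | .inl i => contDiffOn_pi.1 (contDiffOn_pd hU hr i)
    | .inr α => contDiffOn_pi.1 (hn α)

theorem pd_frame (hU : IsOpen U) (hr : ContDiffOn ℝ ∞ r U)
    (hn : ∀ α, ContDiffOn ℝ ∞ (n α) U) (hu : u ∈ U) (k : Fin N) :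
    pd k (frame r n) u =
      Matrix.of (Sum.elim (fun i => pd k (pd i r) u) (fun α => pd k (n α) u)) := by
  ext a b
  rw [pd_matrix_apply (differentiableAt_of_contDiffOn hU (contDiffOn_frame hU hr hn) hu)]
  rcases a with i | α
  · exact (pd_apply (differentiableAt_of_contDiffOn hU (contDiffOn_pd hU hr i) hu) b).symm
  · exact (pd_apply (differentiableAt_of_contDiffOn hU (hn α) hu) b).symm

theorem frame_mul_pseudoGram_mul_transpose
    (hnormal : ∀ α i, pseudoInner (n α u) (pd i r u) = 0)
    (hgram : ∀ α β, pseudoInner (n α u) (n β u) = μ α β) :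
    frame r n u * pseudoGram p q * (frame r n u)ᵀ = Matrix.fromBlocks (firstForm r u) 0 0 μ := by
  ext (i | α) (j | β) <;> rw [mul_pseudoGram_mul_transpose_apply]
  · rfl
  · exact (pseudoInner_comm _ _).trans (hnormal β i)
  · exact hnormal α j
  · exact hgram α β

theorem IsFlatTorsionlessIn.gram_frame (h : IsFlatTorsionlessIn U η μ r n) (hu : u ∈ U) :
    frame r n u * pseudoGram p q * (frame r n u)ᵀ = Matrix.fromBlocks η 0 0 μ := by
  rw [frame_mul_pseudoGram_mul_transpose (h.1.normal u hu) (h.1.gram u hu), h.2 u hu]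

theorem firstForm_isSymm (r : (Fin N → ℝ) → PseudoE p q) (u : Fin N → ℝ) :
    (firstForm r u).IsSymm :=
  Matrix.IsSymm.ext fun _ _ => pseudoInner_comm _ _

theorem card_frame_eq (hpq : p + q = N + L) :
    Fintype.card (Fin N ⊕ Fin L) = Fintype.card (Fin p ⊕ Fin q) := by
  simp [hpq]

theorem IsFlatTorsionless.isMetric (h : IsFlatTorsionless U μ r n) (hpq : p + q = N + L)
    (hu : u ∈ U) : IsMetric (firstForm r u) ∧ IsMetric μ := by
  have hdet := det_fromBlocks_ne_zero_iff.1 <| det_ne_zero_of_linearIndependent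
    (card_frame_eq hpq) (pseudoGram_mul_self p q) (h.linearIndependent u hu)
    (frame_mul_pseudoGram_mul_transpose (h.normal u hu) (h.gram u hu))
  exact ⟨⟨firstForm_isSymm r u, hdet.1⟩, Matrix.IsSymm.ext fun α β => by
    rw [← h.gram u hu, ← h.gram u hu, pseudoInner_comm], hdet.2⟩

theorem IsFlatTorsionlessIn.isMetric (h : IsFlatTorsionlessIn U η μ r n) (hpq : p + q = N + L)
    (hne : U.Nonempty) : IsMetric η ∧ IsMetric μ := by
  obtain ⟨u, hu⟩ := hne
  exact h.2 u hu ▸ h.1.isMetric hpq hu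

theorem signatureSum_of_mul_pseudoGram_mul_transpose (hpq : p + q = N + L) (hη : η.det ≠ 0)
    (hμ : μ.det ≠ 0) {M : Matrix (Fin N ⊕ Fin L) (Fin p ⊕ Fin q) ℝ}
    (hM : M * pseudoGram p q * Mᵀ = Matrix.fromBlocks η 0 0 μ) : SignatureSum p q η μ := by
  have h := (mul_mul_transpose_eq_iff (card_frame_eq hpq) (pseudoGram_mul_self p q)
    (det_fromBlocks_ne_zero_iff.2 ⟨hη, hμ⟩)).1 hM
  have hinv : pseudoGram p q * Mᵀ * (Matrix.fromBlocks η 0 0 μ)⁻¹ * M = 1 := by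
    rw [Matrix.mul_assoc, Matrix.mul_assoc, ← Matrix.mul_assoc Mᵀ, h, pseudoGram_mul_self]
  have hequiv := toQuadraticForm'_equivalent_of_mul_diagonal_mul_transpose
    ((Matrix.mul_eq_one_comm_of_card_eq _ _ _ (card_frame_eq hpq)).2 hinv) hinv hM
  rw [signatureSum_iff, hequiv.sigPos_eq, hequiv.sigNeg_eq]
  exact ⟨sigPos_weightedSumSquares_pseudoWeights.symm,
    sigNeg_weightedSumSquares_pseudoWeights.symm⟩

theorem eq_zero_of_symm_of_antisymm {κ : Type*} {T : κ → κ → κ → ℝ}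
    (hsymm : ∀ i j k, T i j k = T j i k) (hanti : ∀ i j k, T i j k = -T i k j) (i j k : κ) :
    T i j k = 0 := by
  linarith [hanti i j k, hsymm i k j, hanti k i j, hsymm k j i, hanti j k i, hsymm j i k]

theorem IsFlatTorsionlessIn.pd_frame_skew (h : IsFlatTorsionlessIn U η μ r n) (hU : IsOpen U)
    (hu : u ∈ U) (k : Fin N) (a b : Fin N ⊕ Fin L) :
    pseudoInner (pd k (frame r n) u a) (frame r n u b) =
      -pseudoInner (pd k (frame r n) u b) (frame r n u a) := by
  have hM := contDiffOn_frame hU h.1.smooth_r h.1.smooth_n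
  have hMd := differentiableAt_of_contDiffOn hU hM hu
  have hD : ContDiffOn ℝ ∞ (fun _ : Fin N → ℝ => pseudoGram p q) U := contDiffOn_const
  have hMT := differentiableAt_of_contDiffOn hU (contDiffOn_transpose hM) hu
  have hconst := pd_congr (i := k) hU (fun v hv => h.gram_frame hv) hu
  rw [pd_const, pd_matrix_mul (differentiableAt_of_contDiffOn hU (contDiffOn_matrix_mul hM hD) hu)
    hMT, pd_matrix_mul hMd (differentiableAt_const _), pd_const, pd_transpose hMd,
    Matrix.mul_zero, add_zero] at hconst
  have hab := congrFun (congrFun hconst a) b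
  rw [Matrix.add_apply, mul_pseudoGram_mul_transpose_apply, mul_pseudoGram_mul_transpose_apply,
    pseudoInner_comm (frame r n u a)] at hab
  exact eq_neg_of_add_eq_zero_left hab

theorem IsFlatTorsionlessIn.pd_frame_mul (h : IsFlatTorsionlessIn U η μ r n) (hU : IsOpen U)
    (hφ : ∀ u ∈ U, ∀ α, secondForm r (n α) u = φ α u) (hu : u ∈ U) (k : Fin N) :
    pd k (frame r n) u * pseudoGram p q * (frame r n u)ᵀ =
      Matrix.fromBlocks 0 (slice φ k u) (-(slice φ k u)ᵀ) 0 := by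
  have hpd := pd_frame hU h.1.smooth_r h.1.smooth_n hu
  have hsecond : ∀ i α, pseudoInner (pd k (frame r n) u (.inl i)) (n α u) = slice φ k u i α :=
    fun i α => by
      rw [hpd, pseudoInner_comm]
      exact congrFun (congrFun (hφ u hu α) i) k
  ext (i | α) (j | β) <;> rw [mul_pseudoGram_mul_transpose_apply]
  · refine eq_zero_of_symm_of_antisymm
      (T := fun k i j => pseudoInner (pd k (frame r n) u (.inl i)) (pd j r u)) ?_
      (fun k i j => h.pd_frame_skew hU hu k (.inl i) (.inl j)) k i j
    intro k i j
    rw [hpd, hpd]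
    exact congrArg (pseudoInner · _) (pd_comm hU h.1.smooth_r hu)
  · exact hsecond i β
  · exact (h.pd_frame_skew hU hu k (.inr α) (.inl j)).trans (congrArg Neg.neg (hsecond j α))
  · rw [hpd]
    exact h.1.torsionless u hu α β k

theorem IsFlatTorsionlessIn.isParallel_frame (h : IsFlatTorsionlessIn U η μ r n)
    (hpq : p + q = N + L) (hU : IsOpen U) (hη : η.det ≠ 0) (hμ : μ.det ≠ 0)
    (hφ : ∀ u ∈ U, ∀ α, secondForm r (n α) u = φ α u) :
    IsParallel U (fun k u => frameConnection η μ (slice φ k u)) (frame r n) := by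
  refine ⟨contDiffOn_frame hU h.1.smooth_r h.1.smooth_n, fun u hu k => ?_⟩
  rw [eq_mul_iff_mul_mul_transpose_eq (card_frame_eq hpq) (pseudoGram_mul_self p q)
    (det_fromBlocks_ne_zero_iff.2 ⟨hη, hμ⟩) (h.gram_frame hu),
    frameConnection_mul_fromBlocks hη hμ, h.pd_frame_mul hU hφ hu]

end Frames

section FundamentalEquations

open scoped Matrix Matrix.Norms.Operator

variable {N L p q : ℕ} {U : Set (Fin N → ℝ)} {u : Fin N → ℝ} {η : Matrix (Fin N) (Fin N) ℝ}
  {μ : Matrix (Fin L) (Fin L) ℝ} {r : (Fin N → ℝ) → PseudoE p q}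
  {n : Fin L → (Fin N → ℝ) → PseudoE p q} {ψ : Fin L → (Fin N → ℝ) → ℝ}

theorem gaussEqs_iff : GaussEqs U μ ψ ↔ ∀ u ∈ U, ∀ k l : Fin N,
    slice (fun α => hessian (ψ α)) k u * μ⁻¹ * (slice (fun α => hessian (ψ α)) l u)ᵀ =
      slice (fun α => hessian (ψ α)) l u * μ⁻¹ * (slice (fun α => hessian (ψ α)) k u)ᵀ := by
  have hentry : ∀ u (i j k l : Fin N), (slice (fun α => hessian (ψ α)) k u * μ⁻¹ *
      (slice (fun α => hessian (ψ α)) l u)ᵀ) i j =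
        ∑ α, ∑ β, μ⁻¹ α β * (hessian (ψ α) u i k * hessian (ψ β) u j l) := fun u i j k l => by
    simp only [Matrix.mul_apply, Finset.sum_mul, Matrix.transpose_apply, slice, Matrix.of_apply]
    rw [Finset.sum_comm]
    exact Finset.sum_congr rfl fun α _ => Finset.sum_congr rfl fun β _ => by ring
  simp only [GaussEqs, ← Matrix.ext_iff, hentry, mul_sub, Finset.sum_sub_distrib, sub_eq_zero]
  exact forall₂_congr fun u _ => ⟨fun h k l i j => h i j k l, fun h i j k l => h k l i j⟩

theorem ricciEqs_iff : RicciEqs U η ψ ↔ ∀ u ∈ U, ∀ k l : Fin N,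
    (slice (fun α => hessian (ψ α)) k u)ᵀ * η⁻¹ * slice (fun α => hessian (ψ α)) l u =
      (slice (fun α => hessian (ψ α)) l u)ᵀ * η⁻¹ * slice (fun α => hessian (ψ α)) k u := by
  have hentry : ∀ u α β k l, ((slice (fun α => hessian (ψ α)) k u)ᵀ * η⁻¹ *
      slice (fun α => hessian (ψ α)) l u) α β =
        ∑ i, ∑ j, η⁻¹ i j * (hessian (ψ α) u i k * hessian (ψ β) u j l) := fun u α β k l => by
    simp only [Matrix.mul_apply, Finset.sum_mul, Matrix.transpose_apply, slice, Matrix.of_apply]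
    rw [Finset.sum_comm]
    exact Finset.sum_congr rfl fun i _ => Finset.sum_congr rfl fun j _ => by ring
  simp only [RicciEqs, ← Matrix.ext_iff, hentry, mul_sub, Finset.sum_sub_distrib, sub_eq_zero]
  exact forall₂_congr fun u _ => ⟨fun h k l α β => h α β k l, fun h α β k l => h k l α β⟩

theorem isSolution_iff_hasZeroCurvature (hU : IsOpen U) (hη : η.det ≠ 0) (hμ : μ.det ≠ 0)
    (hψ : ∀ α, ContDiffOn ℝ ∞ (ψ α) U) : IsSolution U η μ ψ ↔
      HasZeroCurvature U fun k u => frameConnection η μ (slice (fun α => hessian (ψ α)) k u) := by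
  have hΩ : ∀ u ∈ U, ∀ k, DifferentiableAt ℝ (slice (fun α => hessian (ψ α)) k) u :=
    fun u hu k => differentiableAt_of_contDiffOn hU
      (contDiffOn_slice (fun α => contDiffOn_hessian hU (hψ α)) k) hu
  have hcodazzi : ∀ u ∈ U, ∀ k l, pd l (slice (fun α => hessian (ψ α)) k) u =
      pd k (slice (fun α => hessian (ψ α)) l) u := fun u hu k l => by
    ext i α
    rw [pd_matrix_apply (hΩ u hu k), pd_matrix_apply (hΩ u hu l)]
    exact pd_comm hU (contDiffOn_pd hU (hψ α) i) hu
  rw [hasZeroCurvature_frameConnection_iff hη hμ hΩ, IsSolution, gaussEqs_iff, ricciEqs_iff]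
  exact ⟨fun h u hu k l => ⟨hcodazzi u hu k l, h.2.1 u hu k l, h.2.2 u hu k l⟩,
    fun h => ⟨hψ, fun u hu k l => (h u hu k l).2.1, fun u hu k l => (h u hu k l).2.2⟩⟩

theorem contDiffOn_secondForm {m : (Fin N → ℝ) → PseudoE p q} (hU : IsOpen U)
    (hr : ContDiffOn ℝ ∞ r U) (hm : ContDiffOn ℝ ∞ m U) (i j : Fin N) :
    ContDiffOn ℝ ∞ (fun u => secondForm r m u i j) U :=
  contDiffOn_pseudoInner hm (contDiffOn_pd hU (contDiffOn_pd hU hr i) j)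

theorem IsFlatTorsionlessIn.hasZeroCurvature {φ : Fin L → (Fin N → ℝ) → Matrix (Fin N) (Fin N) ℝ}
    (h : IsFlatTorsionlessIn U η μ r n) (hpq : p + q = N + L) (hU : IsOpen U) (hη : η.det ≠ 0)
    (hμ : μ.det ≠ 0) (hφ : ∀ u ∈ U, ∀ α, secondForm r (n α) u = φ α u)
    (hφs : ∀ α i j, ContDiffOn ℝ ∞ (fun v => φ α v i j) U) :
    HasZeroCurvature U fun k u => frameConnection η μ (slice φ k u) :=
  (h.isParallel_frame hpq hU hη hμ hφ).hasZeroCurvature hU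
    (contDiffOn_frameConnection (contDiffOn_slice hφs)) fun _ hu =>
      mul_eq_one_of_mul_mul_transpose_eq (det_fromBlocks_ne_zero_iff.2 ⟨hη, hμ⟩) (h.gram_frame hu)

theorem IsFlatTorsionlessIn.isSolution (h : IsFlatTorsionlessIn U η μ r n) (hpq : p + q = N + L)
    (hU : IsOpen U) (hη : η.det ≠ 0) (hμ : μ.det ≠ 0) (hψ : ∀ α, ContDiffOn ℝ ∞ (ψ α) U)
    (hH : HasHessianForms U r n ψ) : IsSolution U η μ ψ :=
  (isSolution_iff_hasZeroCurvature hU hη hμ hψ).2 <|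
    h.hasZeroCurvature hpq hU hη hμ hH fun α => contDiffOn_hessian hU (hψ α)

theorem IsFlatTorsionlessIn.exists_hasHessianForms (h : IsFlatTorsionlessIn U η μ r n)
    (hpq : p + q = N + L) (hU : IsOpen U) (hUs : IsSimplyConnected U) (hη : η.det ≠ 0)
    (hμ : μ.det ≠ 0) :
    ∃ ψ : Fin L → (Fin N → ℝ) → ℝ, (∀ α, ContDiffOn ℝ ∞ (ψ α) U) ∧ HasHessianForms U r n ψ := by
  have hsmooth : ∀ α i j, ContDiffOn ℝ ∞ (fun u => secondForm r (n α) u i j) U := fun α =>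
    contDiffOn_secondForm hU h.1.smooth_r (h.1.smooth_n α)
  have hΩ : ∀ u ∈ U, ∀ k, DifferentiableAt ℝ (slice (fun α => secondForm r (n α)) k) u :=
    fun u hu k => differentiableAt_of_contDiffOn hU (contDiffOn_slice hsmooth k) hu
  have hcurv := (hasZeroCurvature_frameConnection_iff hη hμ hΩ).1
    (h.hasZeroCurvature hpq hU hη hμ (fun _ _ _ => rfl) hsmooth)
  have hcodazzi : ∀ α, ∀ u ∈ U, ∀ i j k, pd k (fun v => secondForm r (n α) v i j) u =
      pd j (fun v => secondForm r (n α) v i k) u := fun α u hu i j k => by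
    have hentry := congrFun (congrFun (hcurv u hu j k).1 i) α
    rwa [pd_matrix_apply (hΩ u hu j), pd_matrix_apply (hΩ u hu k)] at hentry
  choose ψ hψ hH using fun α => exists_hessian_eq hU hUs (hsmooth α)
    (fun u hu i j => congrArg (pseudoInner (n α u)) (pd_comm hU h.1.smooth_r hu)) (hcodazzi α)
  exact ⟨ψ, hψ, fun u hu α => Matrix.ext fun i j => (hH α u hu i j).symm⟩

theorem HasHessianForms.iff_exists_affine {ψ' : Fin L → (Fin N → ℝ) → ℝ}
    (hH : HasHessianForms U r n ψ) (hU : IsOpen U) (hc : IsPreconnected U)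
    (hψ : ∀ α, ContDiffOn ℝ ∞ (ψ α) U) :
    ((∀ α, ContDiffOn ℝ ∞ (ψ' α) U) ∧ HasHessianForms U r n ψ') ↔
      ∃ (a : Fin L → Fin N → ℝ) (c : Fin L → ℝ), ∀ u ∈ U, ∀ α, ψ' α u = ψ α u + a α ⬝ᵥ u + c α := by
  constructor
  · rintro ⟨hψ', hH'⟩
    choose a c h using fun α => exists_eqOn_add_affine hU hc (hψ α) (hψ' α)
      fun u hu => (hH' u hu α).symm.trans (hH u hu α)
    exact ⟨a, c, fun u hu α => h α u hu⟩
  · rintro ⟨a, c, h⟩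
    have hsmooth : ∀ α, ContDiffOn ℝ ∞ (fun u => ψ α u + a α ⬝ᵥ u + c α) U := fun α =>
      ((hψ α).add (by unfold dotProduct; fun_prop)).add contDiffOn_const
    refine ⟨fun α => (hsmooth α).congr fun u hu => h u hu α, fun u hu α => ?_⟩
    have hpd : ∀ i, EqOn (pd i (ψ' α)) (pd i fun v => ψ α v + a α ⬝ᵥ v + c α) U :=
      fun i v hv => pd_congr hU (fun w hw => h w hw α) hv
    rw [hH u hu α, ← hessian_add_affine hU (hψ α) hu (a α) (c α)]
    exact Matrix.ext fun i j => (pd_congr hU (hpd i) hu).symm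

theorem exists_solution_of_isFlatTorsionlessIn (hpq : p + q = N + L) (hU : IsOpen U)
    (hUs : IsSimplyConnected U) (h : IsFlatTorsionlessIn U η μ r n) :
    IsMetric η ∧ IsMetric μ ∧ SignatureSum p q η μ ∧ ∃ ψ : Fin L → (Fin N → ℝ) → ℝ,
      IsSolution U η μ ψ ∧ HasHessianForms U r n ψ ∧ ∀ ψ' : Fin L → (Fin N → ℝ) → ℝ,
        (IsSolution U η μ ψ' ∧ HasHessianForms U r n ψ') ↔
          ∃ (a : Fin L → Fin N → ℝ) (c : Fin L → ℝ),
            ∀ u ∈ U, ∀ α, ψ' α u = ψ α u + a α ⬝ᵥ u + c α := by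
  obtain ⟨u₀, hu₀⟩ := hUs.nonempty
  obtain ⟨hη, hμ⟩ := h.isMetric hpq ⟨u₀, hu₀⟩
  obtain ⟨ψ, hψ, hH⟩ := h.exists_hasHessianForms hpq hU hUs hη.2 hμ.2
  have hsol : ∀ {ψ' : Fin L → (Fin N → ℝ) → ℝ}, (∀ α, ContDiffOn ℝ ∞ (ψ' α) U) →
      HasHessianForms U r n ψ' → IsSolution U η μ ψ' := h.isSolution hpq hU hη.2 hμ.2
  refine ⟨hη, hμ, signatureSum_of_mul_pseudoGram_mul_transpose hpq hη.2 hμ.2 (h.gram_frame hu₀),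
    ψ, hsol hψ hH, hH, fun ψ' => ?_⟩
  rw [← hH.iff_exists_affine hU hUs.isPathConnected.isConnected.isPreconnected hψ]
  exact and_congr_left fun hH' => ⟨And.left, fun hψ' => hsol hψ' hH'⟩

end FundamentalEquations

section Bonnet

open scoped Matrix Matrix.Norms.Operator

variable {N L p q : ℕ} {U : Set (Fin N → ℝ)} {u : Fin N → ℝ} {η : Matrix (Fin N) (Fin N) ℝ}
  {μ : Matrix (Fin L) (Fin L) ℝ} {r r' : (Fin N → ℝ) → PseudoE p q}
  {n n' : Fin L → (Fin N → ℝ) → PseudoE p q} {ψ : Fin L → (Fin N → ℝ) → ℝ}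

theorem riemann_eq_zero_of_const {g : (Fin N → ℝ) → Matrix (Fin N) (Fin N) ℝ} (hU : IsOpen U)
    (hg : ∀ u ∈ U, g u = η) (hu : u ∈ U) (l k i j : Fin N) : riemann g l k i j u = 0 := by
  have hpd : ∀ u ∈ U, ∀ i a b, pd i (fun v => g v a b) u = 0 := fun u hu i a b => by
    rw [pd_congr (g := fun _ => η a b) hU (fun v hv => by simp only [hg v hv]) hu, pd_const]
  have hΓ : ∀ k i j, EqOn (christoffel g k i j) (fun _ => 0) U := fun k i j u hu => by
    simp [christoffel, hpd u hu]
  have hpdΓ : ∀ k i j l, pd l (christoffel g k i j) u = 0 := fun k i j l => by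
    rw [pd_congr hU (hΓ k i j) hu, pd_const]
  simp [riemann, hpdΓ, hΓ _ _ _ hu]

variable {φ : Fin L → (Fin N → ℝ) → Matrix (Fin N) (Fin N) ℝ}

theorem isFlatTorsionlessIn_of_isParallel_frame (hpq : p + q = N + L) (hU : IsOpen U)
    (hη : η.det ≠ 0) (hμ : μ.det ≠ 0) (hr : ContDiffOn ℝ ∞ r U)
    (hn : ∀ α, ContDiffOn ℝ ∞ (n α) U)
    (hgram : ∀ u ∈ U, frame r n u * pseudoGram p q * (frame r n u)ᵀ = Matrix.fromBlocks η 0 0 μ)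
    (hpar : IsParallel U (fun k u => frameConnection η μ (slice φ k u)) (frame r n)) :
    IsFlatTorsionlessIn U η μ r n ∧ ∀ u ∈ U, ∀ α, secondForm r (n α) u = φ α u := by
  have hdet := det_fromBlocks_ne_zero_iff.2 ⟨hη, hμ⟩
  have hinner : ∀ u ∈ U, ∀ a b, pseudoInner (frame r n u a) (frame r n u b) =
      Matrix.fromBlocks η 0 0 μ a b := fun u hu a b => by
    rw [← hgram u hu, mul_pseudoGram_mul_transpose_apply]
  have hpd : ∀ u ∈ U, ∀ k a b, pseudoInner (pd k (frame r n) u a) (frame r n u b) =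
      Matrix.fromBlocks 0 (slice φ k u) (-(slice φ k u)ᵀ) 0 a b := fun u hu k a b => by
    rw [← mul_pseudoGram_mul_transpose_apply, ← frameConnection_mul_fromBlocks hη hμ,
      (eq_mul_iff_mul_mul_transpose_eq (card_frame_eq hpq) (pseudoGram_mul_self p q) hdet
        (hgram u hu)).1 (hpar.2 u hu k)]
  have hfirst : ∀ u ∈ U, firstForm r u = η := fun u hu =>
    Matrix.ext fun i j => hinner u hu (.inl i) (.inl j)
  refine ⟨⟨⟨hr, hn, fun u hu => linearIndependent_of_det_ne_zero hdet (hgram u hu),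
    fun u hu => (hfirst u hu).symm ▸ hη, fun u hu α i => hinner u hu (.inr α) (.inl i),
    fun u hu α β => hinner u hu (.inr α) (.inr β), fun u hu α β i => ?_,
    fun u hu => riemann_eq_zero_of_const hU hfirst hu⟩, hfirst⟩, fun u hu α => ?_⟩
  · have h := hpd u hu i (.inr α) (.inr β)
    rwa [pd_frame hU hr hn hu] at h
  · ext i k
    have h := hpd u hu k (.inl i) (.inr α)
    rw [pd_frame hU hr hn hu, pseudoInner_comm] at h
    exact h

theorem exists_isParallel_gram_eq (hpq : p + q = N + L) (hU : IsOpen U)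
    (hUs : IsSimplyConnected U) (hη : IsMetric η) (hμ : IsMetric μ) (hsig : SignatureSum p q η μ)
    (hφ : ∀ α i j, ContDiffOn ℝ ∞ (fun u => φ α u i j) U)
    (hcurv : HasZeroCurvature U fun k u => frameConnection η μ (slice φ k u)) :
    ∃ M : (Fin N → ℝ) → Matrix (Fin N ⊕ Fin L) (Fin p ⊕ Fin q) ℝ,
      IsParallel U (fun k u => frameConnection η μ (slice φ k u)) M ∧
        ∀ u ∈ U, M u * pseudoGram p q * (M u)ᵀ = Matrix.fromBlocks η 0 0 μ := by
  obtain ⟨u₀, hu₀⟩ := hUs.nonempty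
  have hdet := det_fromBlocks_ne_zero_iff.2 ⟨hη.2, hμ.2⟩
  obtain ⟨hp, hq⟩ := signatureSum_iff.1 hsig
  obtain ⟨M₀, hM₀⟩ := exists_mul_pseudoGram_mul_transpose_eq
    (hη.1.fromBlocks Matrix.transpose_zero hμ.1) hdet hp hq
  obtain ⟨M, hMu₀, hM⟩ := hcurv.exists_isParallel hU hUs
    (contDiffOn_frameConnection (contDiffOn_slice hφ)) hu₀ M₀
  obtain ⟨P, hP⟩ := (preservesMetric_frameConnection hη.1 hμ.1 hη.2 hμ.2
    (slice φ)).exists_transpose_mul_inv_mul_eq hU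
      hUs.isPathConnected.isConnected.isPreconnected hM hM
  have hgram := fun u => mul_mul_transpose_eq_iff (M := M u) (card_frame_eq hpq)
    (pseudoGram_mul_self p q) hdet
  refine ⟨M, hM, fun u hu => (hgram u).2 ?_⟩
  rw [hP u hu, ← hP u₀ hu₀, ← hgram, hMu₀, hM₀]

/-- The tangent rows of a parallel frame are closed because the quadratic forms `φ_α` are
symmetric. -/
theorem IsParallel.exists_pd_eq {M : (Fin N → ℝ) → Matrix (Fin N ⊕ Fin L) (Fin p ⊕ Fin q) ℝ}
    (hM : IsParallel U (fun k u => frameConnection η μ (slice φ k u)) M) (hU : IsOpen U)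
    (hUs : IsSimplyConnected U) (hφ : ∀ u ∈ U, ∀ α i j, φ α u i j = φ α u j i) :
    ∃ r : (Fin N → ℝ) → PseudoE p q,
      ContDiffOn ℝ ∞ r U ∧ ∀ u ∈ U, ∀ i, pd i r u = M u (.inl i) := by
  have hMs : ∀ a, ContDiffOn ℝ ∞ (fun u => M u a) U := fun a =>
    contDiffOn_pi.2 fun b => contDiffOn_matrix_iff.1 hM.1 a b
  have hpd : ∀ u ∈ U, ∀ k i, pd k (fun v => M v (.inl i)) u =
      Sum.elim 0 (slice φ k u i ᵥ* μ⁻¹) ᵥ* M u := fun u hu k i => by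
    ext b
    rw [pd_apply (differentiableAt_of_contDiffOn hU (hMs _) hu),
      ← pd_matrix_apply (differentiableAt_of_contDiffOn hU hM.1 hu), hM.2 u hu]
    rfl
  refine exists_potential hU hUs (fun i => hMs (.inl i)) fun u hu i j => ?_
  have hslice : slice φ j u i = slice φ i u j := funext fun α => hφ u hu α i j
  rw [hpd u hu, hpd u hu, hslice]

theorem exists_isFlatTorsionlessIn (hpq : p + q = N + L) (hU : IsOpen U)
    (hUs : IsSimplyConnected U) (hη : IsMetric η) (hμ : IsMetric μ) (hsig : SignatureSum p q η μ)
    (hs : IsSolution U η μ ψ) :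
    ∃ (r : (Fin N → ℝ) → PseudoE p q) (n : Fin L → (Fin N → ℝ) → PseudoE p q),
      IsFlatTorsionlessIn U η μ r n ∧ HasHessianForms U r n ψ := by
  obtain ⟨M, hM, hgram⟩ := exists_isParallel_gram_eq hpq hU hUs hη hμ hsig
    (fun α => contDiffOn_hessian hU (hs.1 α))
    ((isSolution_iff_hasZeroCurvature hU hη.2 hμ.2 hs.1).1 hs)
  obtain ⟨r, hr, hrM⟩ := hM.exists_pd_eq hU hUs fun u hu α => hessian_symm hU (hs.1 α) hu
  have hframe : EqOn (frame r fun α u => M u (.inr α)) M U := fun u hu => by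
    ext (i | α) b
    · exact congrFun (hrM u hu i) b
    · rfl
  refine ⟨r, fun α u => M u (.inr α), isFlatTorsionlessIn_of_isParallel_frame hpq hU hη.2 hμ.2 hr
    (fun α => contDiffOn_pi.2 fun b => contDiffOn_matrix_iff.1 hM.1 (.inr α) b)
    (fun u hu => ?_) ⟨hM.1.congr hframe, fun u hu k => ?_⟩⟩
  · rw [hframe hu, hgram u hu]
  · rw [pd_congr hU hframe hu, hframe hu, hM.2 u hu k]

theorem pseudoInner_vecMul {Q : Matrix (Fin p ⊕ Fin q) (Fin p ⊕ Fin q) ℝ}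
    (hQ : Q * pseudoGram p q * Qᵀ = pseudoGram p q) (x y : PseudoE p q) :
    pseudoInner (x ᵥ* Q) (y ᵥ* Q) = pseudoInner x y := by
  rw [pseudoInner_eq_dotProduct, pseudoInner_eq_dotProduct]
  conv_rhs => rw [← hQ, ← Matrix.mulVec_mulVec, ← Matrix.mulVec_mulVec, Matrix.mulVec_transpose,
    Matrix.dotProduct_mulVec x Q]

theorem congruent_of_frame_eq_mul {Q : Matrix (Fin p ⊕ Fin q) (Fin p ⊕ Fin q) ℝ} (hU : IsOpen U)
    (hc : IsPreconnected U) (hr : ContDiffOn ℝ ∞ r U) (hr' : ContDiffOn ℝ ∞ r' U)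
    (hQ : Q * pseudoGram p q * Qᵀ = pseudoGram p q)
    (hframe : ∀ u ∈ U, frame r' n' u = frame r n u * Q) : Congruent U r r' n n' := by
  have hinv : Q * (pseudoGram p q * Qᵀ * pseudoGram p q) = 1 := by
    rw [← Matrix.mul_assoc, ← Matrix.mul_assoc, hQ, pseudoGram_mul_self]
  let T := Matrix.toLinearEquivRight'OfInv (mul_eq_one_comm.1 hinv) hinv
  have hT : ∀ x, T x = x ᵥ* Q := fun x => rfl
  let T' := LinearMap.toContinuousLinearMap T.toLinearMap
  obtain ⟨c, hc⟩ := exists_eqOn_add_const_of_pd_eq (f := fun u => T' (r u)) hU hc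
    (fun u hu => T'.differentiableAt.comp u (differentiableAt_of_contDiffOn hU hr hu))
    (fun u hu => differentiableAt_of_contDiffOn hU hr' hu) fun u hu i => by
      rw [pd_clm T' (differentiableAt_of_contDiffOn hU hr hu)]
      exact congrFun (hframe u hu) (.inl i)
  refine ⟨T, c, fun x y => ?_, fun u hu => ⟨hc u hu, fun α => congrFun (hframe u hu) (.inr α)⟩⟩
  rw [hT, hT, pseudoInner_vecMul hQ]

theorem congruent_of_hasHessianForms (hpq : p + q = N + L) (hU : IsOpen U)
    (hc : IsConnected U) (h : IsFlatTorsionlessIn U η μ r n)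
    (hH : HasHessianForms U r n ψ) (h' : IsFlatTorsionlessIn U η μ r' n')
    (hH' : HasHessianForms U r' n' ψ) : Congruent U r r' n n' := by
  obtain ⟨u, hu⟩ := hc.nonempty
  obtain ⟨hη, hμ⟩ := h.isMetric hpq hc.nonempty
  have hdet := det_fromBlocks_ne_zero_iff.2 ⟨hη.2, hμ.2⟩
  obtain ⟨P, hP⟩ := (preservesMetric_frameConnection hη.1 hμ.1 hη.2 hμ.2
    _).exists_transpose_mul_inv_mul_eq hU hc.isPreconnected
      (h.isParallel_frame hpq hU hη.2 hμ.2 hH)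
      (h'.isParallel_frame hpq hU hη.2 hμ.2 hH')
  have hframe : ∀ u ∈ U, frame r' n' u = frame r n u * (pseudoGram p q * P) := fun u hu => by
    have hinv := mul_eq_one_of_mul_mul_transpose_eq hdet (h.gram_frame hu)
    rw [← hP u hu, ← Matrix.mul_assoc (pseudoGram p q), ← Matrix.mul_assoc (pseudoGram p q),
      ← Matrix.mul_assoc, hinv, Matrix.one_mul]
  refine congruent_of_frame_eq_mul hU hc.isPreconnected h.1.smooth_r h'.1.smooth_r ?_ hframe
  refine mul_mul_transpose_injective (card_frame_eq hpq) hdet (h.gram_frame hu) ?_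
  dsimp only
  rw [h.gram_frame hu, ← h'.gram_frame hu, hframe u hu, Matrix.transpose_mul (frame r n u)]
  simp only [Matrix.mul_assoc]

end Bonnet

section Jacobian

variable {N : ℕ} {κ : Type} {u : Fin N → ℝ}

/-- The Jacobian matrix `(∂fᵃ/∂uⁱ)`. -/
noncomputable def jacobian (f : (Fin N → ℝ) → κ → ℝ) (u : Fin N → ℝ) : Matrix κ (Fin N) ℝ :=
  LinearMap.toMatrix' (fderiv ℝ f u : (Fin N → ℝ) →ₗ[ℝ] κ → ℝ)

theorem jacobian_apply [Fintype κ] (f : (Fin N → ℝ) → κ → ℝ) (u : Fin N → ℝ) (a : κ)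
    (i : Fin N) : jacobian f u a i = pd i f u a := by
  simp [jacobian, LinearMap.toMatrix'_apply, pd]

theorem jacobian_comp [Finite κ] {f : (Fin N → ℝ) → κ → ℝ} {e : (Fin N → ℝ) → Fin N → ℝ}
    (hf : DifferentiableAt ℝ f (e u)) (he : DifferentiableAt ℝ e u) :
    jacobian (f ∘ e) u = jacobian f (e u) * jacobian e u := by
  have := Fintype.ofFinite κ
  rw [jacobian, fderiv_comp u hf he]
  exact LinearMap.toMatrix'_comp _ _

end Jacobian

section FlatMetric

open scoped Matrix Matrix.Norms.Operator

variable {N : ℕ} {U : Set (Fin N → ℝ)} {u u₀ : Fin N → ℝ}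
  {g : (Fin N → ℝ) → Matrix (Fin N) (Fin N) ℝ}

/-- The matrix `Γᵢ = (Γˡ_{ik})`, with rows `l` and columns `k`, of the Levi-Civita connection of
`g` in the coordinate frame. -/
noncomputable def christoffelMatrix (g : (Fin N → ℝ) → Matrix (Fin N) (Fin N) ℝ) (i : Fin N)
    (u : Fin N → ℝ) : Matrix (Fin N) (Fin N) ℝ :=
  Matrix.of fun l k => christoffel g l i k u

theorem contDiffOn_christoffelMatrix (hU : IsOpen U) (hg : ContDiffOn ℝ ∞ g U)
    (hdet : ∀ u ∈ U, (g u).det ≠ 0) (i : Fin N) : ContDiffOn ℝ ∞ (christoffelMatrix g i) U := by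
  have hpd : ∀ s a b, ContDiffOn ℝ ∞ (fun u => pd s (fun v => g v a b) u) U := fun s a b =>
    contDiffOn_pd hU (contDiffOn_matrix_iff.1 hg a b) s
  exact contDiffOn_matrix_iff.2 fun l k => contDiffOn_const.mul <| ContDiffOn.sum fun s _ =>
    (contDiffOn_matrix_iff.1 (contDiffOn_matrix_inv hg hdet) l s).mul
      (((hpd i k s).add (hpd k i s)).sub (hpd s i k))

theorem christoffel_symm (hU : IsOpen U) (hsymm : ∀ u ∈ U, (g u).IsSymm) (hu : u ∈ U)
    (l i k : Fin N) : christoffel g l i k u = christoffel g l k i u := by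
  have hpd : ∀ s, pd s (fun v => g v i k) u = pd s (fun v => g v k i) u := fun s =>
    pd_congr hU (fun v hv => (hsymm v hv).apply k i) hu
  simp only [christoffel, hpd, add_comm]

theorem mul_christoffelMatrix_apply (hU : IsOpen U) (hg : ContDiffOn ℝ ∞ g U)
    (hdet : ∀ u ∈ U, (g u).det ≠ 0) (hu : u ∈ U) (s i k : Fin N) :
    (g u * christoffelMatrix g i u) s k =
      (pd i g u k s + pd k g u i s - pd s g u i k) / 2 := by
  let F : Matrix (Fin N) (Fin N) ℝ :=
    Matrix.of fun s k => (pd i g u k s + pd k g u i s - pd s g u i k) / 2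
  have hF : christoffelMatrix g i u = (g u)⁻¹ * F := by
    ext l k
    rw [Matrix.mul_apply]
    simp only [christoffelMatrix, christoffel, F, Matrix.of_apply, Finset.mul_sum,
      pd_matrix_apply (differentiableAt_of_contDiffOn hU hg hu)]
    exact Finset.sum_congr rfl fun s _ => by ring
  rw [hF, ← Matrix.mul_assoc, Matrix.mul_nonsing_inv _ (hdet u hu).isUnit, Matrix.one_mul]
  rfl

theorem preservesMetric_christoffelMatrix (hU : IsOpen U) (hg : ContDiffOn ℝ ∞ g U)
    (hdet : ∀ u ∈ U, (g u).det ≠ 0) (hsymm : ∀ u ∈ U, (g u).IsSymm) :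
    PreservesMetric U (fun i u => (christoffelMatrix g i u)ᵀ) g := by
  refine ⟨hg, hdet, fun u hu i => ?_⟩
  have hpd : (pd i g u)ᵀ = pd i g u := by
    rw [← pd_transpose (differentiableAt_of_contDiffOn hU hg hu)]
    exact pd_congr hU hsymm hu
  have hlower : (christoffelMatrix g i u)ᵀ * g u = (g u * christoffelMatrix g i u)ᵀ := by
    rw [Matrix.transpose_mul, hsymm u hu]
  ext s k
  rw [hlower, Matrix.transpose_transpose, Matrix.add_apply, Matrix.transpose_apply,
    mul_christoffelMatrix_apply hU hg hdet hu, mul_christoffelMatrix_apply hU hg hdet hu]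
  linarith [congrFun (congrFun hpd k) s, Matrix.transpose_apply (pd i g u) k s]

theorem hasZeroCurvature_christoffelMatrix (hU : IsOpen U) (hg : ContDiffOn ℝ ∞ g U)
    (hdet : ∀ u ∈ U, (g u).det ≠ 0) (hflat : ∀ u ∈ U, ∀ l k i j, riemann g l k i j u = 0) :
    HasZeroCurvature U fun i u => (christoffelMatrix g i u)ᵀ := by
  intro u hu i j
  have hd := fun i =>
    differentiableAt_of_contDiffOn hU (contDiffOn_christoffelMatrix hU hg hdet i) hu
  rw [pd_transpose (hd i), pd_transpose (hd j)]
  ext k l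
  simp only [Matrix.add_apply, Matrix.transpose_apply, Matrix.mul_apply, pd_matrix_apply (hd _)]
  have h := hflat u hu l k j i
  rw [riemann, Finset.sum_sub_distrib] at h
  simp only [christoffelMatrix, Matrix.of_apply, mul_comm (christoffel g _ _ k u)]
  linarith

theorem exists_isParallel_metric_eq (hU : IsOpen U) (hUs : IsSimplyConnected U)
    (hg : ContDiffOn ℝ ∞ g U) (hmetric : ∀ u ∈ U, IsMetric (g u))
    (hflat : ∀ u ∈ U, ∀ l k i j, riemann g l k i j u = 0) (hu₀ : u₀ ∈ U) :
    ∃ Y : (Fin N → ℝ) → Matrix (Fin N) (Fin N) ℝ,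
      IsParallel U (fun i u => (christoffelMatrix g i u)ᵀ) Y ∧
        ∀ u ∈ U, g u = Y u * g u₀ * (Y u)ᵀ := by
  have hdet := fun u hu => (hmetric u hu).2
  obtain ⟨Y, hY₀, hY⟩ := (hasZeroCurvature_christoffelMatrix hU hg hdet hflat).exists_isParallel
    hU hUs (fun i => contDiffOn_transpose (contDiffOn_christoffelMatrix hU hg hdet i)) hu₀
    (1 : Matrix (Fin N) (Fin N) ℝ)
  obtain ⟨P, hP⟩ := (preservesMetric_christoffelMatrix hU hg hdet fun u hu =>
    (hmetric u hu).1).exists_transpose_mul_inv_mul_eq hU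
      hUs.isPathConnected.isConnected.isPreconnected hY hY
  have hconst : ∀ u ∈ U, (Y u)ᵀ * (g u)⁻¹ * Y u = (g u₀)⁻¹ := fun u hu => by
    rw [hP u hu, ← hP u₀ hu₀, hY₀, Matrix.transpose_one, Matrix.one_mul, Matrix.mul_one]
  refine ⟨Y, hY, fun u hu => ?_⟩
  have hinv : Y u * g u₀ * ((Y u)ᵀ * (g u)⁻¹) = 1 := by
    rw [mul_eq_one_comm, ← Matrix.mul_assoc, hconst u hu,
      Matrix.nonsing_inv_mul _ (hdet u₀ hu₀).isUnit]
  rw [← Matrix.one_mul (g u), ← hinv, ← Matrix.mul_assoc, Matrix.mul_assoc _ _ (g u),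
    Matrix.nonsing_inv_mul _ (hdet u hu).isUnit, Matrix.mul_one]

theorem exists_flat_map (hU : IsOpen U) (hUs : IsSimplyConnected U)
    (hg : ContDiffOn ℝ ∞ g U) (hmetric : ∀ u ∈ U, IsMetric (g u))
    (hflat : ∀ u ∈ U, ∀ l k i j, riemann g l k i j u = 0) (hu₀ : u₀ ∈ U) :
    ∃ V : (Fin N → ℝ) → Fin N → ℝ, ContDiffOn ℝ ∞ V U ∧
      ∀ u ∈ U, g u = (jacobian V u)ᵀ * g u₀ * jacobian V u := by
  obtain ⟨Y, hY, hgY⟩ := exists_isParallel_metric_eq hU hUs hg hmetric hflat hu₀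
  have hYs : ∀ i, ContDiffOn ℝ ∞ (fun u => Y u i) U := fun i =>
    contDiffOn_pi.2 fun b => contDiffOn_matrix_iff.1 hY.1 i b
  have hpd : ∀ u ∈ U, ∀ i j, pd j (fun v => Y v i) u =
      (fun m => christoffel g m j i u) ᵥ* Y u := fun u hu i j => by
    ext b
    rw [pd_apply (differentiableAt_of_contDiffOn hU (hYs i) hu),
      ← pd_matrix_apply (differentiableAt_of_contDiffOn hU hY.1 hu), hY.2 u hu]
    rfl
  obtain ⟨V, hV, hVY⟩ := exists_potential hU hUs hYs fun u hu i j => by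
    simp only [hpd u hu, christoffel_symm hU (fun v hv => (hmetric v hv).1) hu _ i j]
  have hjac : ∀ u ∈ U, jacobian V u = (Y u)ᵀ := fun u hu => by
    ext a i
    rw [jacobian_apply, hVY u hu, Matrix.transpose_apply]
  exact ⟨V, hV, fun u hu => by rw [hjac u hu, Matrix.transpose_transpose, ← hgY u hu]⟩

end FlatMetric

section CoordinateChange

open scoped Matrix Matrix.Norms.Operator

variable {N L p q : ℕ} {U W : Set (Fin N → ℝ)} {u u₀ v : Fin N → ℝ}
  {e V : (Fin N → ℝ) → Fin N → ℝ} {η : Matrix (Fin N) (Fin N) ℝ} {μ : Matrix (Fin L) (Fin L) ℝ}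
  {r : (Fin N → ℝ) → PseudoE p q} {n : Fin L → (Fin N → ℝ) → PseudoE p q}

theorem firstForm_eq_jacobian (r : (Fin N → ℝ) → PseudoE p q) (u : Fin N → ℝ) :
    firstForm r u = (jacobian r u)ᵀ * pseudoGram p q * jacobian r u := by
  have hrow : (jacobian r u)ᵀ = Matrix.of fun i => pd i r u :=
    Matrix.ext fun i a => jacobian_apply r u a i
  ext i j
  conv_rhs => rw [← Matrix.transpose_transpose (jacobian r u), hrow,
    mul_pseudoGram_mul_transpose_apply]
  rfl

theorem firstForm_comp (hr : DifferentiableAt ℝ r (e v)) (he : DifferentiableAt ℝ e v) :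
    firstForm (r ∘ e) v = (jacobian e v)ᵀ * firstForm r (e v) * jacobian e v := by
  simp only [firstForm_eq_jacobian, jacobian_comp hr he, Matrix.transpose_mul, Matrix.mul_assoc]

theorem pseudoInner_pd_comp_eq_zero {x : PseudoE p q} (hr : DifferentiableAt ℝ r (e v))
    (he : DifferentiableAt ℝ e v) (h : ∀ i, pseudoInner (pd i r (e v)) x = 0) (i : Fin N) :
    pseudoInner (pd i (r ∘ e) v) x = 0 := by
  have hpd : pd i (r ∘ e) v = ∑ j, pd i e v j • pd j r (e v) := by
    rw [← fderiv_eq_sum_pd, pd, fderiv_comp v hr he]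
    rfl
  simp only [pseudoInner_eq_dotProduct] at h
  simp only [hpd, pseudoInner_eq_dotProduct, sum_dotProduct, smul_dotProduct, h, smul_zero,
    Finset.sum_const_zero]

theorem IsFlatTorsionless.comp (h : IsFlatTorsionless U μ r n) (hU : IsOpen U) (hW : IsOpen W)
    (he : ContDiffOn ℝ ∞ e W) (hWU : MapsTo e W U) (hη : η.det ≠ 0) (hμ : μ.det ≠ 0)
    (hI : ∀ v ∈ W, firstForm (r ∘ e) v = η) :
    IsFlatTorsionlessIn W η μ (r ∘ e) (fun α => n α ∘ e) := by
  have hed : ∀ v ∈ W, DifferentiableAt ℝ e v := fun v hv => differentiableAt_of_contDiffOn hW he hv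
  have hnormal : ∀ v ∈ W, ∀ α i, pseudoInner ((n α ∘ e) v) (pd i (r ∘ e) v) = 0 := by
    intro v hv α i
    rw [pseudoInner_comm]
    refine pseudoInner_pd_comp_eq_zero
      (differentiableAt_of_contDiffOn hU h.smooth_r (hWU hv)) (hed v hv) (fun j => ?_) i
    exact (pseudoInner_comm _ _).trans (h.normal _ (hWU hv) α j)
  have hgram : ∀ v ∈ W, ∀ α β, pseudoInner ((n α ∘ e) v) ((n β ∘ e) v) = μ α β :=
    fun v hv => h.gram _ (hWU hv)
  refine ⟨⟨h.smooth_r.comp he hWU, fun α => (h.smooth_n α).comp he hWU, fun v hv => ?_,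
    fun v hv => (hI v hv).symm ▸ hη, hnormal, hgram, fun v hv α β i => ?_,
    fun v hv => riemann_eq_zero_of_const hW hI hv⟩, hI⟩
  · exact linearIndependent_of_det_ne_zero (det_fromBlocks_ne_zero_iff.2 ⟨hη, hμ⟩)
      (hI v hv ▸ frame_mul_pseudoGram_mul_transpose (hnormal v hv) (hgram v hv))
  · exact pseudoInner_pd_comp_eq_zero
      (differentiableAt_of_contDiffOn hU (h.smooth_n α) (hWU hv)) (hed v hv)
      (fun j => h.torsionless _ (hWU hv) α β j) i

theorem isSimplyConnected_ball (x : Fin N → ℝ) {ε : ℝ} (hε : 0 < ε) :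
    IsSimplyConnected (ball x ε) := by
  have := (convex_ball x ε).contractibleSpace (nonempty_ball.2 hε)
  exact SimplyConnectedSpace.ofContractible _

theorem exists_restrict_isSimplyConnected_source
    (e : OpenPartialHomeomorph (Fin N → ℝ) (Fin N → ℝ)) (hu₀ : u₀ ∈ e.target) :
    ∃ e' : OpenPartialHomeomorph (Fin N → ℝ) (Fin N → ℝ), ⇑e' = e ∧ ⇑e'.symm = e.symm ∧
      e'.source ⊆ e.source ∧ e'.target ⊆ e.target ∧ u₀ ∈ e'.target ∧
      IsSimplyConnected e'.source := by
  obtain ⟨ε, hε, hball⟩ := Metric.isOpen_iff.1 e.open_source _ (e.map_target hu₀)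
  refine ⟨e.restrOpen (ball (e.symm u₀) ε) isOpen_ball, rfl, rfl, inter_subset_left,
    inter_subset_left, ⟨hu₀, mem_ball_self hε⟩, ?_⟩
  rw [OpenPartialHomeomorph.restrOpen_source, inter_eq_right.2 hball]
  exact isSimplyConnected_ball _ hε

theorem exists_openPartialHomeomorph (hU : IsOpen U) (hV : ContDiffOn ℝ ∞ V U)
    (hdet : ∀ u ∈ U, (jacobian V u).det ≠ 0) (hu₀ : u₀ ∈ U) :
    ∃ e : OpenPartialHomeomorph (Fin N → ℝ) (Fin N → ℝ), ⇑e.symm = V ∧ e.target ⊆ U ∧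
      u₀ ∈ e.target ∧ ContDiffOn ℝ ∞ e e.source := by
  have hdet' : ∀ u ∈ U, (fderiv ℝ V u).det ≠ 0 := fun u hu => by
    rw [ContinuousLinearMap.det, ← LinearMap.det_toMatrix']
    exact hdet u hu
  have hder : ∀ u (hu : u ∈ U), HasFDerivAt V (((fderiv ℝ V u).toContinuousLinearEquivOfDetNeZero
      (hdet' u hu) : (Fin N → ℝ) ≃L[ℝ] (Fin N → ℝ)) : (Fin N → ℝ) →L[ℝ] (Fin N → ℝ)) u :=
    fun u hu => by
      rw [ContinuousLinearMap.coe_toContinuousLinearEquivOfDetNeZero]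
      exact (differentiableAt_of_contDiffOn hU hV hu).hasFDerivAt
  have hVa : ∀ u ∈ U, ContDiffAt ℝ ∞ V u := fun u hu => hV.contDiffAt (hU.mem_nhds hu)
  have hn : (∞ : WithTop ℕ∞) ≠ 0 := by simp
  let φ := ((hVa u₀ hu₀).toOpenPartialHomeomorph V (hder u₀ hu₀) hn).restrOpen U hU
  have hφU : φ.source ⊆ U := inter_subset_right
  refine ⟨φ.symm, rfl, hφU, ⟨(hVa u₀ hu₀).mem_toOpenPartialHomeomorph_source (hder u₀ hu₀) hn, hu₀⟩,
    fun v hv => ?_⟩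
  have hvU : φ.symm v ∈ U := hφU (φ.map_target hv)
  exact (φ.contDiffAt_symm hv (hder _ hvU) (hVa _ hvU)).contDiffWithinAt

theorem firstForm_comp_eq_const {e : OpenPartialHomeomorph (Fin N → ℝ) (Fin N → ℝ)}
    (he : ContDiffOn ℝ ∞ e e.source) (heV : ContDiffOn ℝ ∞ e.symm e.target)
    (hr : ∀ u ∈ e.target, DifferentiableAt ℝ r u)
    (hI : ∀ u ∈ e.target, firstForm r u = (jacobian e.symm u)ᵀ * η * jacobian e.symm u)
    (hv : v ∈ e.source) : firstForm (r ∘ e) v = η := by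
  have heu := e.map_source hv
  have hed := differentiableAt_of_contDiffOn e.open_source he hv
  have hjac : jacobian e.symm (e v) * jacobian e v = 1 := by
    have hid : e.symm ∘ e =ᶠ[𝓝 v] id :=
      eventually_of_mem (e.open_source.mem_nhds hv) fun w hw => e.left_inv hw
    rw [← jacobian_comp (differentiableAt_of_contDiffOn e.open_target heV heu) hed, jacobian,
      hid.fderiv_eq, fderiv_id]
    exact LinearMap.toMatrix'_id
  calc firstForm (r ∘ e) v
      = (jacobian e.symm (e v) * jacobian e v)ᵀ * η * (jacobian e.symm (e v) * jacobian e v) := by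
        rw [firstForm_comp (hr _ heu) hed, hI _ heu]
        simp only [Matrix.transpose_mul, Matrix.mul_assoc]
    _ = η := by rw [hjac, Matrix.transpose_one, Matrix.one_mul, Matrix.mul_one]

theorem contDiffOn_firstForm (hU : IsOpen U) (hr : ContDiffOn ℝ ∞ r U) :
    ContDiffOn ℝ ∞ (firstForm r) U :=
  contDiffOn_matrix_iff.2 fun i j =>
    contDiffOn_pseudoInner (contDiffOn_pd hU hr i) (contDiffOn_pd hU hr j)

theorem IsFlatTorsionless.exists_flat_coordinates (h : IsFlatTorsionless U μ r n)
    (hpq : p + q = N + L) (hU : IsOpen U) (hu₀ : u₀ ∈ U) :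
    ∃ (η : Matrix (Fin N) (Fin N) ℝ) (e : OpenPartialHomeomorph (Fin N → ℝ) (Fin N → ℝ)),
      IsSimplyConnected e.source ∧ e.target ⊆ U ∧ u₀ ∈ e.target ∧
      ContDiffOn ℝ ∞ e e.source ∧ ContDiffOn ℝ ∞ e.symm e.target ∧
      IsFlatTorsionlessIn e.source η μ (r ∘ e) (fun α => n α ∘ e) := by
  obtain ⟨ε, hε, hball⟩ := Metric.isOpen_iff.1 hU u₀ hu₀
  have hu₀B : u₀ ∈ ball u₀ ε := mem_ball_self hε
  have hmetric : ∀ u ∈ U, IsMetric (firstForm r u) := fun u hu => (h.isMetric hpq hu).1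
  obtain ⟨V, hV, hIV⟩ := exists_flat_map isOpen_ball (isSimplyConnected_ball u₀ hε)
    ((contDiffOn_firstForm hU h.smooth_r).mono hball) (fun u hu => hmetric u (hball hu))
    (fun u hu => h.flat u (hball hu)) hu₀B
  have hdet : ∀ u ∈ ball u₀ ε, (jacobian V u).det ≠ 0 := fun u hu h0 =>
    (hmetric u (hball hu)).2 (by rw [hIV u hu, Matrix.det_mul, h0, mul_zero])
  obtain ⟨e₁, rfl, ht₁, hu₁, he₁⟩ := exists_openPartialHomeomorph isOpen_ball hV hdet hu₀B
  obtain ⟨e, hee₁, hsymm, hsource, htarget, hu₀e, hes⟩ :=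
    exists_restrict_isSimplyConnected_source e₁ hu₁
  rw [← hee₁] at he₁
  rw [← hsymm] at hV hIV
  have he := he₁.mono hsource
  have ht := htarget.trans ht₁
  exact ⟨firstForm r u₀, e, hes, ht.trans hball, hu₀e, he, hV.mono ht,
    h.comp hU e.open_source he (fun v hv => hball (ht (e.map_source hv)))
      (hmetric u₀ hu₀).2 (h.isMetric hpq hu₀).2.2 fun v hv =>
    firstForm_comp_eq_const he (hV.mono ht)
      (fun u hu => differentiableAt_of_contDiffOn hU h.smooth_r (hball (ht hu)))
      (fun u hu => hIV u (ht hu)) hv⟩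

end CoordinateChange

end Submfd

theorem theorem1 (N L p q : ℕ) (hpq : p + q = N + L) :
    -- a flat torsionless submanifold admits flat coordinates near each of its points
    (∀ (U : Set (Fin N → ℝ)) (μ : Matrix (Fin L) (Fin L) ℝ)
        (r : (Fin N → ℝ) → Submfd.PseudoE p q) (n : Fin L → (Fin N → ℝ) → Submfd.PseudoE p q),
      IsOpen U → Submfd.IsFlatTorsionless U μ r n → ∀ u₀ ∈ U,
      ∃ (η : Matrix (Fin N) (Fin N) ℝ) (e : OpenPartialHomeomorph (Fin N → ℝ) (Fin N → ℝ)),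
        IsSimplyConnected e.source ∧ e.target ⊆ U ∧ u₀ ∈ e.target ∧
        ContDiffOn ℝ ∞ e e.source ∧ ContDiffOn ℝ ∞ e.symm e.target ∧
        Submfd.IsFlatTorsionlessIn e.source η μ (r ∘ e) (fun α => n α ∘ e)) ∧
    -- in any flat coordinates, it gives a solution, unique up to affine functions
    (∀ (U : Set (Fin N → ℝ)) (η : Matrix (Fin N) (Fin N) ℝ) (μ : Matrix (Fin L) (Fin L) ℝ)
        (r : (Fin N → ℝ) → Submfd.PseudoE p q) (n : Fin L → (Fin N → ℝ) → Submfd.PseudoE p q),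
      IsOpen U → IsSimplyConnected U → Submfd.IsFlatTorsionlessIn U η μ r n →
      Submfd.IsMetric η ∧ Submfd.IsMetric μ ∧ Submfd.SignatureSum p q η μ ∧
      ∃ ψ : Fin L → (Fin N → ℝ) → ℝ,
        Submfd.IsSolution U η μ ψ ∧ Submfd.HasHessianForms U r n ψ ∧
        ∀ ψ' : Fin L → (Fin N → ℝ) → ℝ,
          (Submfd.IsSolution U η μ ψ' ∧ Submfd.HasHessianForms U r n ψ') ↔
            ∃ (a : Fin L → Fin N → ℝ) (c : Fin L → ℝ),
              ∀ u ∈ U, ∀ α, ψ' α u = ψ α u + ∑ i, a α i * u i + c α) ∧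
    -- each solution gives a flat torsionless submanifold, unique up to motions
    (∀ (U : Set (Fin N → ℝ)) (η : Matrix (Fin N) (Fin N) ℝ) (μ : Matrix (Fin L) (Fin L) ℝ)
        (ψ : Fin L → (Fin N → ℝ) → ℝ),
      IsOpen U → IsSimplyConnected U → Submfd.IsMetric η → Submfd.IsMetric μ →
      Submfd.SignatureSum p q η μ → Submfd.IsSolution U η μ ψ →
      ∃ (r : (Fin N → ℝ) → Submfd.PseudoE p q) (n : Fin L → (Fin N → ℝ) → Submfd.PseudoE p q),
        Submfd.IsFlatTorsionlessIn U η μ r n ∧ Submfd.HasHessianForms U r n ψ ∧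
        ∀ (r' : (Fin N → ℝ) → Submfd.PseudoE p q) (n' : Fin L → (Fin N → ℝ) → Submfd.PseudoE p q),
          Submfd.IsFlatTorsionlessIn U η μ r' n' → Submfd.HasHessianForms U r' n' ψ →
          Submfd.Congruent U r r' n n') := by
  refine ⟨fun U μ r n hU h u₀ hu₀ => h.exists_flat_coordinates hpq hU hu₀,
    fun U η μ r n hU hUs h => Submfd.exists_solution_of_isFlatTorsionlessIn hpq hU hUs h,
    fun U η μ ψ hU hUs hη hμ hsig hs => ?_⟩
  obtain ⟨r, n, h, hH⟩ := Submfd.exists_isFlatTorsionlessIn hpq hU hUs hη hμ hsig hs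
  exact ⟨r, n, h, hH, fun r' n' h' hH' => Submfd.congruent_of_hasHessianForms hpq hU
    hUs.isPathConnected.isConnected h hH h' hH'⟩
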